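/- Let $k$ be a field of characteristic $p>0$, $S=k[[x_1,\dots,x_n]]$, let $I\subsetneq S$ be an ideal generated by squarefree monomials, and let $I=I_{\alpha_1}\cap\cdots\cap I_{\alpha_s}$ be its minimal primary decomposition; its components are the minimal primes of $I$. Put $R=S/I$, let $E_R$ be an injective hull of the residue field of $R$, and let $\mathcal F(E_R)=\bigoplus_{e\ge 0}\mathcal F^e(E_R)$ be its ring of Frobenius operators, where $\mathcal F^e(E_R)$ is the group of additive maps $\varphi:E_R\to E_R$ with $\varphi(rm)=r^{p^e}\varphi(m)$, and multiplication is composition. Call $\mathcal F(E_R)$ principally generated if it is generated as a ring by $\mathcal F^0(E_R)$ and one element of $\mathcal F^1(E_R)$, and infinitely generated if it is not generated as a ring by $\mathcal F^0(E_R)$ and finitely many elements. Write $I^{[q]}$ for the ideal generated by the $q$-th powers of the elements of $I$, and $u=x_1\cdots x_n$. Assume first that $I_{\alpha_1}+\cdots+I_{\alpha_s}=(x_1,\dots,x_n)$. (1) Suppose that one of the following holds: - (i.a) $\operatorname{ht} I_{\alpha_i}>1$ for all $i$, and $(I^{[q]}:_S I)=I^{[q]}+(u^{q-1})$ for some $q=p^e$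 with $e\ge 1$; - (iii) $\operatorname{ht} I_{\alpha_i}=1$ for all $i$. Then $\mathcal F(E_R)$ is principally generated, and $\mathcal F(E_R)\cong R[u^{p-1}\theta;F]$, the skew polynomial ring that is free as a left $R$-module on the powers of the symbol $u^{p-1}\theta$, with $(u^{p-1}\theta)\,r=r^p\,(u^{p-1}\theta)$ for $r\in R$. More precisely, let $E_S$ be an injective hull of the residue field of $S$. There are an identification of $E_R$ with $\{y\in E_S : Iy=0\}$ and a $p$-linear map $\theta:E_S\to E_S$ such that for every $e\ge0$ each $p^e$-linear map $E_S\to E_S$ is $g\theta^e$ for a unique $g\in S$; the map $u^{p-1}\theta$ restricts to $E_R$; and the isomorphism sends $r\in R$ to multiplication by $r$ and the variable to this restriction. (2) Suppose that one of the following holds: - (i.b) $\operatorname{ht} I_{\alpha_i}>1$ for all $i$, and $(I^{[q]}:_S I)\neq I^{[q]}+(u^{q-1})$ for some $q=p^e$ with $e\ge 1$; - (ii) $\operatorname{ht} I=1$ and $\operatorname{ht} I_{\alpha_i}>1$ for some $i$. Then $\mathcal F(E_R)$ is infinitely generated. (3) For every squarefree monomial ideal $I\subsetneq S$, also without the assumption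 $I_{\alpha_1}+\cdots+I_{\alpha_s}=(x_1,\dots,x_n)$, the ring $\mathcal F(E_R)$ is either principally generated or infinitely generated. -/

import Mathlib

universe u v

noncomputable section

open scoped DirectSum

/-! ### Frobenius operators -/

/-- The group `𝓕ᵉ(M)` of `pᵉ`-linear maps `M → M`: the additive maps `φ` such that
`φ (r m) = r ^ (p ^ e) φ m`. -/
def frobeniusOps (p : ℕ) (R : Type u) [CommRing R] (M : Type v) [AddCommGroup M] [Module R M]
    (e : ℕ) : AddSubgroup (AddMonoid.End M) where
  carrier := {φ | ∀ (r : R) (m : M), φ (r • m) = r ^ p ^ e • φ m}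
  add_mem' := by
    intro φ ψ hφ hψ r m
    change φ (r • m) + ψ (r • m) = r ^ p ^ e • (φ m + ψ m)
    rw [hφ, hψ, smul_add]
  zero_mem' := by
    intro r m
    change (0 : M) = r ^ p ^ e • (0 : M)
    rw [smul_zero]
  neg_mem' := by
    intro φ hφ r m
    change -φ (r • m) = r ^ p ^ e • (-φ m)
    rw [hφ, smul_neg]

/-- The composite of a `pᵉ`-linear and a `pᵉ'`-linear map is `pᵉ⁺ᵉ'`-linear. -/
instance frobeniusOps.gradedMonoid (p : ℕ) (R : Type u) [CommRing R] (M : Type v)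
    [AddCommGroup M] [Module R M] : SetLike.GradedMonoid (frobeniusOps p R M) where
  one_mem := by
    intro r m
    change r • m = r ^ p ^ 0 • m
    rw [pow_zero, pow_one]
  mul_mem := by
    intro i j φ ψ hφ hψ r m
    change φ (ψ (r • m)) = r ^ p ^ (i + j) • φ (ψ m)
    rw [hψ, hφ, ← pow_mul, ← pow_add, add_comm j i]

/-- The ring of Frobenius operators `𝓕(M) = ⨁ₑ 𝓕ᵉ(M)`, multiplied by composition. -/
abbrev FrobeniusAlgebra (p : ℕ) (R : Type u) [CommRing R] (M : Type v) [AddCommGroup M]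
    [Module R M] : Type v :=
  ⨁ e, frobeniusOps p R M e

/-- Multiplication by `r : R`, as an element of `𝓕⁰(M) = End_R(M)`. -/
def frobeniusScalar (p : ℕ) (R : Type u) [CommRing R] (M : Type v) [AddCommGroup M]
    [Module R M] (r : R) : frobeniusOps p R M 0 :=
  ⟨Module.toAddMonoidEnd R M r, by
    intro s m
    change r • s • m = s ^ p ^ 0 • r • m
    rw [pow_zero, pow_one, smul_comm]⟩

/-- The subset `S` generates the ring `𝓕(M)` over its degree zero part `𝓕⁰(M)`. -/
def GeneratesFrobeniusAlgebra (p : ℕ) (R : Type u) [CommRing R] (M : Type v) [AddCommGroup M]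
    [Module R M] (S : Set (FrobeniusAlgebra p R M)) : Prop :=
  Subring.closure
    (Set.range (DirectSum.of (fun e => frobeniusOps p R M e) 0) ∪ S) = ⊤

/-- `𝓕(M)` is principally generated: one operator of degree one generates it over `𝓕⁰(M)`. -/
def FrobeniusPrincipallyGenerated (p : ℕ) (R : Type u) [CommRing R] (M : Type v)
    [AddCommGroup M] [Module R M] : Prop :=
  ∃ T : frobeniusOps p R M 1,
    GeneratesFrobeniusAlgebra p R M {DirectSum.of (fun e => frobeniusOps p R M e) 1 T}

/-- `𝓕(M)` is finitely generated over `𝓕⁰(M)`; otherwise it is infinitely generated. -/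
def FrobeniusFinitelyGenerated (p : ℕ) (R : Type u) [CommRing R] (M : Type v)
    [AddCommGroup M] [Module R M] : Prop :=
  ∃ S : Finset (FrobeniusAlgebra p R M), GeneratesFrobeniusAlgebra p R M (S : Set _)

/-! ### Frobenius skew polynomials -/

/-- The additive monoid `ℕ` acting on `R` by the iterates of the Frobenius endomorphism. -/
abbrev frobeniusAction (p : ℕ) (R : Type u) [CommRing R] [ExpChar R p] :
    MulSemiringAction (Multiplicative ℕ) R where
  smul m r := iterateFrobenius R p m.toAdd r
  one_smul r := by
    change iterateFrobenius R p 0 r = r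
    simp
  mul_smul m m' r := by
    change iterateFrobenius R p (m.toAdd + m'.toAdd) r =
      iterateFrobenius R p m.toAdd (iterateFrobenius R p m'.toAdd r)
    rw [iterateFrobenius_add_apply]
  smul_zero m := map_zero (iterateFrobenius R p m.toAdd)
  smul_add m := map_add (iterateFrobenius R p m.toAdd)
  smul_one m := map_one (iterateFrobenius R p m.toAdd)
  smul_mul m := map_mul (iterateFrobenius R p m.toAdd)

/-- The skew polynomial ring `R[X; F]`: the free left `R`-module on `1, X, X², …`, with
`X r = r ^ p X`. -/
def FrobeniusSkewPolynomial (_p : ℕ) (R : Type u) [CommRing R] : Type u :=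
  SkewPolynomial R

namespace FrobeniusSkewPolynomial

instance ring (p : ℕ) (R : Type u) [CommRing R] [ExpChar R p] :
    Ring (FrobeniusSkewPolynomial p R) :=
  letI := frobeniusAction p R
  inferInstanceAs (Ring (SkewPolynomial R))

/-- The constant skew polynomial `r`. -/
def C (p : ℕ) (R : Type u) [CommRing R] (r : R) : FrobeniusSkewPolynomial p R :=
  (SkewPolynomial.C r : SkewPolynomial R)

/-- The skew variable. -/
def X (p : ℕ) (R : Type u) [CommRing R] : FrobeniusSkewPolynomial p R :=
  (SkewPolynomial.X : SkewPolynomial R)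

/-- The commutation rule, which checks that the multiplication is the intended one. -/
theorem X_mul_C (p : ℕ) (R : Type u) [CommRing R] [ExpChar R p] (r : R) :
    X p R * C p R r = C p R (r ^ p) * X p R := by
  let := frobeniusAction p R
  have h : (Multiplicative.ofAdd 1 : Multiplicative ℕ) • r = r ^ p := by
    change iterateFrobenius R p 1 r = r ^ p
    rw [iterateFrobenius_def, pow_one]
  have key : (SkewMonoidAlgebra.single (Multiplicative.ofAdd 1) (1 : R) : SkewPolynomial R) *
      SkewMonoidAlgebra.single 1 r =
      SkewMonoidAlgebra.single 1 (r ^ p) * SkewMonoidAlgebra.single (Multiplicative.ofAdd 1) 1 := by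
    rw [SkewMonoidAlgebra.single_mul_single, SkewMonoidAlgebra.single_mul_single, h]
    simp
  exact key

end FrobeniusSkewPolynomial

/-! ### Injective hulls -/

/-- `E` is an injective hull of the residue field of the local ring `R`: it is an injective module
and an essential extension of a copy of the residue field. -/
def IsInjectiveHullOfResidueField (R : Type u) [CommRing R] [IsLocalRing R] (E : Type u)
    [AddCommGroup E] [Module R E] : Prop :=
  Module.Injective R E ∧
    ∃ j : IsLocalRing.ResidueField R →ₗ[R] E, Function.Injective j ∧
      ∀ N : Submodule R E, N ⊓ LinearMap.range j = ⊥ → N = ⊥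

/-- `θ` is a natural Frobenius action on `E`: a `p`-linear map such that for every `e` each
`pᵉ`-linear map `E → E` is uniquely of the form `g θᵉ` with `g ∈ S`. -/
def IsNaturalFrobenius (p : ℕ) (S : Type u) [CommRing S] (E : Type v) [AddCommGroup E]
    [Module S E] (θ : AddMonoid.End E) : Prop :=
  θ ∈ frobeniusOps p S E 1 ∧
    ∀ e : ℕ, ∀ φ ∈ frobeniusOps p S E e, ∃! g : S, ∀ m : E, φ m = g • (θ ^ e) m

/-- A quotient `≠ 0` of a local ring is local. -/
instance isLocalRing_quotient {S : Type u} [CommRing S] [IsLocalRing S] (I : Ideal S)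
    [Nontrivial (S ⧸ I)] : IsLocalRing (S ⧸ I) :=
  .of_surjective' _ Ideal.Quotient.mk_surjective

/-- `𝓕(E_R) = R[vθ; F]` for `R = S/I`. Here `E` and `E'` are meant to be the injective hulls of the
residue fields of `R` and of `S`. The statement says that there are an identification `ι` of `E`
with the annihilator of `I` in `E'`, a natural Frobenius action `θ` on `E'`, and a `p`-linear
operator `T` on `E` which is the restriction of `vθ`, such that `X ↦ T` defines an isomorphism of
the skew polynomial ring `R[X; F]` onto `𝓕(E)` which is the structure map on `R`. -/
def FrobeniusAlgebraIsSkewPolynomialOn (p : ℕ) {S : Type u} [CommRing S] (I : Ideal S)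
    [ExpChar (S ⧸ I) p] (E : Type u) [AddCommGroup E] [Module (S ⧸ I) E]
    (E' : Type u) [AddCommGroup E'] [Module S E'] (v : S) : Prop :=
  ∃ (ι : E →+ E') (θ : AddMonoid.End E') (T : frobeniusOps p (S ⧸ I) E 1)
    (Φ : FrobeniusSkewPolynomial p (S ⧸ I) ≃+* FrobeniusAlgebra p (S ⧸ I) E),
    Function.Injective ι ∧
    (∀ (s : S) (m : E), ι (Ideal.Quotient.mk I s • m) = s • ι m) ∧
    Set.range ι = {y : E' | ∀ a ∈ I, a • y = 0} ∧
    IsNaturalFrobenius p S E' θ ∧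
    (∀ m : E, ι ((T : AddMonoid.End E) m) = v • θ (ι m)) ∧
    (∀ r : S ⧸ I, Φ (FrobeniusSkewPolynomial.C p (S ⧸ I) r) =
      DirectSum.of (fun e => frobeniusOps p (S ⧸ I) E e) 0 (frobeniusScalar p (S ⧸ I) E r)) ∧
    Φ (FrobeniusSkewPolynomial.X p (S ⧸ I)) =
      DirectSum.of (fun e => frobeniusOps p (S ⧸ I) E e) 1 T

/-! ### Squarefree monomial ideals -/

/-- `I` is generated by squarefree monomials. -/
def IsSquarefreeMonomialIdeal {k : Type u} [Field k] {n : ℕ}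
    (I : Ideal (MvPowerSeries (Fin n) k)) : Prop :=
  ∃ G : Set (Finset (Fin n)),
    I = Ideal.span ((fun g : Finset (Fin n) => ∏ i ∈ g, MvPowerSeries.X i) '' G)

/-- The Frobenius power `I^{[q]}`, generated by the `q`-th powers of the elements of `I`. -/
def frobeniusPower {S : Type u} [CommRing S] (I : Ideal S) (q : ℕ) : Ideal S :=
  Ideal.span ((fun f : S => f ^ q) '' (I : Set S))

/-- A nonzero quotient of a power series ring over a field of characteristic `p` has
characteristic `p`. -/
instance charP_quotient_mvPowerSeries {k : Type u} [Field k] (p : ℕ) [CharP k p] {n : ℕ}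
    (I : Ideal (MvPowerSeries (Fin n) k)) [Nontrivial (MvPowerSeries (Fin n) k ⧸ I)] :
    CharP (MvPowerSeries (Fin n) k ⧸ I) p :=
  charP_of_injective_algebraMap
    (algebraMap k (MvPowerSeries (Fin n) k ⧸ I)).injective p

/-- The product `x₁ ⋯ xₙ` of all the variables. -/
def prodVars (k : Type u) [Field k] (n : ℕ) : MvPowerSeries (Fin n) k :=
  ∏ i : Fin n, MvPowerSeries.X i

end

/-!
Let `S` be the power series ring, `θ` the natural Frobenius action on the injective hull of its
residue field, and `q = pᵉ`. Macaulay's inverse polynomials, on which power series act by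
contraction, are a model of that hull (`InversePolynomial.isInjectiveHullOfResidueField`, by the
Artin-Rees lemma), and the hull of the residue field of `R = S ⧸ I` is the annihilator of `I` in it.
By comparing coefficients, every `q`-linear operator on this annihilator is the restriction of some
`g θᵉ` with `g ∈ (I^{[q]} : I)`, and `g` is unique modulo `I^{[q]}`
(`InversePolynomial.exists_forall_eq_smul_frob` and the two criteria following it). Composition is
`(g θᵉ)(h θᵉ') = g h^q θᵉ⁺ᵉ'`.

All ideals in sight are spanned by monomials, so the rest is combinatorics of exponents. The minimal
primes of `I` are generated by the minimal vertex covers of the supports of the generators, and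
`(I^{[q]} : I)` is the intersection of the ideals `P^{[q]} + (∏_{xᵢ ∈ P} xᵢ^{q-1})` over the minimal
primes `P`. A monomial of `(I^{[q]} : I)` is thus described by the set `T` of variables with exponent
`≥ q` and the set of those with exponent `< q - 1`. Whether there is one outside of `I^{[q]}` that is
not divisible by `∏ xᵢ^{q-1}`, over the variables in the minimal primes, does not depend on `q > 1`:
it amounts to the existence of an *obstruction* `T` (`IsObstruction`).

Without an obstruction, `(I^{[q]} : I) = I^{[q]} + (u^{q-1})` for all `q`. As `u^{q-1} θᵉ` is the
`e`-th power of `u^{p-1} θ` and `(I^{[q]} : u^{q-1}) = I`, the operators of degree `e` form the free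
`R`-module on that power (`IsInverseSystem.exists_generator`), which gives the skew polynomial ring.
With an obstruction, take `T` minimal. In each positive degree the monomial attached to `T` is not a multiple
of a product of monomials of lower positive degrees (`not_add_le_obstructionExponent`), so every
such degree needs a new generator (`IsInverseSystem.not_frobeniusFinitelyGenerated`).

It remains to see which case occurs: there is no obstruction if all minimal primes are generated by
one variable (`not_isObstruction_of_card_eq_one`), and there is one if some but not all are
(`exists_isObstruction_of_card`); the height of a minimal prime tells whether it is generated by one
variable.
-/

/-! ### Combinatorics of squarefree monomials and of their minimal vertex covers -/

section Combinatorics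

variable {σ : Type*}

/-- The exponents of the monomials in `I^{[q]}`, where `I` is generated by the squarefree monomials
with supports in `G`. For `q = 1` these are the exponents of the monomials in `I`. -/
def monomialExponents (G : Set (Finset σ)) (q : ℕ) : Set (σ →₀ ℕ) :=
  {a | ∃ g ∈ G, ∀ i ∈ g, q ≤ a i}

/-- The exponents of the monomials in `(I^{[q]} : I)`. -/
def colonExponents (G : Set (Finset σ)) (q : ℕ) : Set (σ →₀ ℕ) :=
  {b | ∀ c ∈ monomialExponents G 1, b + c ∈ monomialExponents G q}

/-- `α` meets every member of `G`. -/
def IsVertexCover (G : Set (Finset σ)) (α : Finset σ) : Prop :=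
  ∀ g ∈ G, ∃ i ∈ g, i ∈ α

/-- `α` is an inclusion-minimal vertex cover of `G`; these correspond to the minimal primes of `I`.
-/
def IsMinimalCover (G : Set (Finset σ)) (α : Finset σ) : Prop :=
  Minimal (IsVertexCover G) α

/-- The variables that occur in some minimal prime of `I`. -/
def coverVars (G : Set (Finset σ)) : Set σ :=
  {i | ∃ α, IsMinimalCover G α ∧ i ∈ α}

/-- `i` lies only on minimal covers that meet `T`. -/
def CoversThroughMeet (G : Set (Finset σ)) (T : Finset σ) (i : σ) : Prop :=
  ∀ α, IsMinimalCover G α → i ∈ α → ∃ j ∈ α, j ∈ T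

/-- The combinatorial obstruction to principal generation: `T` misses some minimal cover, but meets
every minimal cover through a suitable variable outside of `T`. If a monomial lies in
`(I^{[q]} : I)`, but neither in `I^{[q]}` nor in `(∏ xᵢ^{q-1})`, the variables with exponent `≥ q`
form such a set `T`. -/
def IsObstruction (G : Set (Finset σ)) (T : Finset σ) : Prop :=
  (∃ i ∈ coverVars G, i ∉ T ∧ CoversThroughMeet G T i) ∧
    ∃ α, IsMinimalCover G α ∧ ∀ j ∈ α, j ∉ T

theorem monomialExponents_mono {G : Set (Finset σ)} {q : ℕ} {a b : σ →₀ ℕ} (hab : a ≤ b)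
    (ha : a ∈ monomialExponents G q) : b ∈ monomialExponents G q := by
  obtain ⟨g, hg, h⟩ := ha
  exact ⟨g, hg, fun i hi => (h i hi).trans (hab i)⟩

theorem colonExponents_mono {G : Set (Finset σ)} {q : ℕ} {a b : σ →₀ ℕ} (hab : a ≤ b)
    (ha : a ∈ colonExponents G q) : b ∈ colonExponents G q :=
  fun c hc => monomialExponents_mono (add_le_add_left hab c) (ha c hc)

theorem IsMinimalCover.eq_of_subset {G : Set (Finset σ)} {α β : Finset σ}
    (hα : IsMinimalCover G α) (hβ : IsMinimalCover G β) (h : α ⊆ β) : α = β :=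
  le_antisymm h (hβ.2 hα.1 h)

/-- A minimal cover has, for each of its elements, a member of `G` which it meets only there. -/
theorem IsMinimalCover.exists_private {G : Set (Finset σ)} {α : Finset σ}
    (hα : IsMinimalCover G α) {i : σ} (hi : i ∈ α) : ∃ g ∈ G, i ∈ g ∧ ∀ j ∈ g, j ∈ α → j = i := by
  classical
  by_contra! h
  have hc : IsVertexCover G (α.erase i) := by
    intro g hg
    obtain ⟨j, hjg, hjα⟩ := hα.1 g hg
    by_cases hji : j = i
    · obtain ⟨l, hl, hlα, hli⟩ := h g hg (hji ▸ hjg)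
      exact ⟨l, hl, Finset.mem_erase.2 ⟨hli, hlα⟩⟩
    · exact ⟨j, hjg, Finset.mem_erase.2 ⟨hji, hjα⟩⟩
  exact Finset.notMem_erase i α (hα.2 hc (Finset.erase_subset i α) hi)

theorem IsVertexCover.exists_minimal {G : Set (Finset σ)} {α : Finset σ}
    (hα : IsVertexCover G α) : ∃ β ⊆ α, IsMinimalCover G β := by
  obtain ⟨β, hβ, hm⟩ := exists_minimal_le_of_wellFoundedLT (IsVertexCover G) α hα
  exact ⟨β, hβ, hm⟩

theorem exists_minimal_obstruction {G : Set (Finset σ)} {T : Finset σ} (hT : IsObstruction G T) :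
    ∃ T', Minimal (IsObstruction G) T' := by
  obtain ⟨T', -, hm⟩ := exists_minimal_le_of_wellFoundedLT (IsObstruction G) T hT
  exact ⟨T', hm⟩

theorem not_isObstruction_of_card_eq_one {G : Set (Finset σ)}
    (h : ∀ α, IsMinimalCover G α → α.card = 1) (T : Finset σ) : ¬ IsObstruction G T := by
  rintro ⟨⟨i, ⟨α, hα, hiα⟩, hiT, hm⟩, -⟩
  obtain ⟨j, hj, hjT⟩ := hm α hα hiα
  have := Finset.card_le_one.1 (h α hα).le i hiα j hj
  exact hiT (this ▸ hjT)

variable [Fintype σ]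

theorem mem_monomialExponents_iff {G : Set (Finset σ)} {q : ℕ} {a : σ →₀ ℕ} :
    a ∈ monomialExponents G q ↔ ∀ α, IsMinimalCover G α → ∃ i ∈ α, q ≤ a i := by
  classical
  constructor
  · rintro ⟨g, hg, h⟩ α hα
    obtain ⟨i, hig, hiα⟩ := hα.1 g hg
    exact ⟨i, hiα, h i hig⟩
  · intro h
    by_contra hc
    have hcov : IsVertexCover G (Finset.univ.filter fun i => a i < q) := by
      intro g hg
      by_contra! hg'
      exact hc ⟨g, hg, fun i hi => by simpa using hg' i hi⟩
    obtain ⟨β, hβ, hm⟩ := hcov.exists_minimal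
    obtain ⟨i, hi, hqi⟩ := h β hm
    have := hβ hi
    simp only [Finset.mem_filter, Finset.mem_univ, true_and] at this
    omega

/-- `(I^{[q]} : I)` is the intersection over the minimal primes `P` of
`P^{[q]} + (∏_{xᵢ ∈ P} xᵢ^{q-1})`. -/
theorem mem_colonExponents_iff {G : Set (Finset σ)} {q : ℕ} {b : σ →₀ ℕ} :
    b ∈ colonExponents G q ↔
      ∀ α, IsMinimalCover G α → (∃ i ∈ α, q ≤ b i) ∨ ∀ i ∈ α, q ≤ b i + 1 := by
  classical
  constructor
  · intro h α hα
    by_contra! hc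
    obtain ⟨h1, i, hi, h2⟩ := hc
    obtain ⟨g, hg, hig, hg'⟩ := hα.exists_private hi
    let c : σ →₀ ℕ := Finsupp.equivFunOnFinite.symm fun j => if j ∈ g then 1 else 0
    have hc : c ∈ monomialExponents G 1 := ⟨g, hg, fun j hj => by simp [c, hj]⟩
    obtain ⟨j, hj, hqj⟩ := mem_monomialExponents_iff.1 (h c hc) α hα
    have hcj : c j = if j ∈ g then 1 else 0 := rfl
    rw [Finsupp.add_apply, hcj] at hqj
    split_ifs at hqj with hjg
    · obtain rfl := hg' j hjg hj
      omega
    · have := h1 j hj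
      omega
  · intro h c hc
    refine mem_monomialExponents_iff.2 fun α hα => ?_
    rcases h α hα with ⟨i, hi, hq⟩ | h'
    · exact ⟨i, hi, by rw [Finsupp.add_apply]; omega⟩
    · obtain ⟨i, hi, hci⟩ := mem_monomialExponents_iff.1 hc α hα
      exact ⟨i, hi, by rw [Finsupp.add_apply]; have := h' i hi; omega⟩

/-- A monomial of `(I^{[q]} : I)` outside of `I^{[q]} + (∏ xᵢ^{q-1})` exhibits an obstruction. -/
theorem isObstruction_filter {G : Set (Finset σ)} {q : ℕ} {b : σ →₀ ℕ}
    (hb : b ∈ colonExponents G q) (hb' : b ∉ monomialExponents G q) {i : σ}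
    (hi : i ∈ coverVars G) (hbi : b i + 1 < q) :
    IsObstruction G (Finset.univ.filter fun i => q ≤ b i) := by
  refine ⟨⟨i, hi, by simp; omega, fun α hα hiα => ?_⟩, ?_⟩
  · rcases mem_colonExponents_iff.1 hb α hα with ⟨j, hj, hqj⟩ | h
    · exact ⟨j, hj, by simpa using hqj⟩
    · have := h i hiα
      omega
  · by_contra! hc
    refine hb' (mem_monomialExponents_iff.2 fun α hα => ?_)
    obtain ⟨j, hj, hjT⟩ := hc α hα
    exact ⟨j, hj, by simpa using hjT⟩

open Classical in
/-- The exponent attached to a set `T` of variables: `q` on `T`, and outside of `T` either `q - 1`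
or, where that does not lead out of `(I^{[q]} : I)`, zero. -/
noncomputable def obstructionExponent (G : Set (Finset σ)) (T : Finset σ) (q : ℕ) : σ →₀ ℕ :=
  Finsupp.equivFunOnFinite.symm fun i =>
    if i ∈ T then q else if CoversThroughMeet G T i then 0 else q - 1

open Classical in
theorem obstructionExponent_apply (G : Set (Finset σ)) (T : Finset σ) (q : ℕ) (i : σ) :
    obstructionExponent G T q i =
      if i ∈ T then q else if CoversThroughMeet G T i then 0 else q - 1 := rfl

theorem obstructionExponent_mem_colon (G : Set (Finset σ)) (T : Finset σ) (q : ℕ) :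
    obstructionExponent G T q ∈ colonExponents G q := by
  refine mem_colonExponents_iff.2 fun α hα => ?_
  by_cases h : ∃ j ∈ α, j ∈ T
  · obtain ⟨j, hj, hjT⟩ := h
    exact .inl ⟨j, hj, by simp [obstructionExponent_apply, hjT]⟩
  · refine .inr fun i hi => ?_
    have h1 : i ∉ T := fun hiT => h ⟨i, hi, hiT⟩
    have h2 : ¬ CoversThroughMeet G T i := fun hc => h (hc α hα hi)
    rw [obstructionExponent_apply, if_neg h1, if_neg h2]
    omega

theorem obstructionExponent_notMem {G : Set (Finset σ)} {T : Finset σ} (hT : IsObstruction G T)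
    {q : ℕ} (hq : 1 ≤ q) : obstructionExponent G T q ∉ monomialExponents G q := by
  obtain ⟨-, α, hα, h⟩ := hT
  intro hm
  obtain ⟨i, hi, hqi⟩ := mem_monomialExponents_iff.1 hm α hα
  rw [obstructionExponent_apply, if_neg (h i hi)] at hqi
  split_ifs at hqi <;> omega

theorem exists_obstructionExponent_eq_zero {G : Set (Finset σ)} {T : Finset σ}
    (hT : IsObstruction G T) (q : ℕ) : ∃ i ∈ coverVars G, obstructionExponent G T q i = 0 := by
  obtain ⟨⟨i, hi, hiT, hc⟩, -⟩ := hT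
  exact ⟨i, hi, by rw [obstructionExponent_apply, if_neg hiT, if_pos hc]⟩

/-- For a minimal obstruction `T`, the monomial attached to `T` in `(I^{[qq']} : I)` is not a
multiple of a product `f g^q` of monomials `f ∈ (I^{[q]} : I)` and `g ∈ (I^{[q']} : I)`. The variables
with exponent `≥ q'` in `g` would again form an obstruction contained in `T`, hence equal to `T`;
this leaves no room for the variables with exponent `≥ q` in `f`. -/
theorem not_add_le_obstructionExponent {G : Set (Finset σ)} {T : Finset σ}
    (hT : Minimal (IsObstruction G) T) {q q' : ℕ} (hq : 2 ≤ q) (hq' : 2 ≤ q') {b c : σ →₀ ℕ}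
    (hb : b ∈ colonExponents G q) (hc : c ∈ colonExponents G q') :
    ¬ b + q • c ≤ obstructionExponent G T (q * q') := by
  intro hle
  have hle' : ∀ i, b i + q * c i ≤ obstructionExponent G T (q * q') i := fun i => by
    simpa using hle i
  have hqq : 0 < q * q' := by positivity
  -- Outside of `T` the exponents of `g` are smaller than `q'`.
  have hout : ∀ i, i ∉ T → b i + q * c i < q * q' := fun i hi => by
    have := hle' i
    rw [obstructionExponent_apply, if_neg hi] at this
    split_ifs at this <;> omega
  have hc_lt : ∀ i, i ∉ T → c i < q' := fun i hi => by
    have := hout i hi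
    by_contra! h
    have := Nat.mul_le_mul_left q h
    omega
  obtain ⟨⟨i₀, hi₀, hi₀T, hmeet⟩, α₀, hα₀, hα₀T⟩ := hT.1
  have h0 : b i₀ + q * c i₀ ≤ 0 := by
    have := hle' i₀
    rwa [obstructionExponent_apply, if_neg hi₀T, if_pos hmeet] at this
  have hb0 : b i₀ = 0 := by omega
  have hc0 : c i₀ = 0 := by
    have : q * c i₀ = 0 := by omega
    rcases Nat.mul_eq_zero.1 this with h | h <;> omega
  have hcmem : c ∉ monomialExponents G q' := fun hm => by
    obtain ⟨i, hi, hqi⟩ := mem_monomialExponents_iff.1 hm α₀ hα₀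
    have := hc_lt i (hα₀T i hi)
    omega
  have hTc : ∀ i ∈ T, q' ≤ c i := by
    have hsub : (Finset.univ.filter fun i => q' ≤ c i) ≤ T := fun i hi => by
      by_contra hiT
      have := hc_lt i hiT
      simp only [Finset.mem_filter, Finset.mem_univ, true_and] at hi
      omega
    have := hT.2 (isObstruction_filter hc hcmem hi₀ (by omega)) hsub
    intro i hi
    simpa using this hi
  obtain ⟨α, hα, hi₀α⟩ := hi₀
  obtain ⟨i, hi, hbi⟩ : ∃ i ∈ α, q ≤ b i := by
    rcases mem_colonExponents_iff.1 hb α hα with h | h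
    · exact h
    · have := h i₀ hi₀α
      omega
  by_cases hiT : i ∈ T
  · have h1 := hle' i
    rw [obstructionExponent_apply, if_pos hiT] at h1
    have := Nat.mul_le_mul_left q (hTc i hiT)
    omega
  · have hci : c i + 1 < q' := by
      have := hout i hiT
      by_contra! h
      have := Nat.mul_le_mul_left q h
      rw [mul_add] at this
      omega
    have hmeet' : CoversThroughMeet G T i := by
      intro β hβ hiβ
      rcases mem_colonExponents_iff.1 hc β hβ with ⟨j, hj, hqj⟩ | h
      · refine ⟨j, hj, ?_⟩
        by_contra hjT
        have := hc_lt j hjT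
        omega
      · have := h i hiβ
        omega
    have h1 := hle' i
    rw [obstructionExponent_apply, if_neg hiT, if_pos hmeet'] at h1
    omega

/-- Without an obstruction, `(I^{[q]} : I) ⊆ I^{[q]} + (∏ xᵢ^{q-1})` for monomials. -/
theorem le_add_one_of_not_isObstruction {G : Set (Finset σ)} (hG : ∀ T, ¬ IsObstruction G T)
    {q : ℕ} {b : σ →₀ ℕ} (hb : b ∈ colonExponents G q) (hb' : b ∉ monomialExponents G q) {i : σ}
    (hi : i ∈ coverVars G) : q ≤ b i + 1 := by
  by_contra! h
  exact hG _ (isObstruction_filter hb hb' hi h)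

theorem mem_colonExponents_of_le {G : Set (Finset σ)} {q : ℕ} {b : σ →₀ ℕ}
    (h : ∀ i ∈ coverVars G, q ≤ b i + 1) : b ∈ colonExponents G q :=
  mem_colonExponents_iff.2 fun α hα => .inr fun i hi => h i ⟨α, hα, hi⟩

/-- A minimal cover with one element `j` and another one, containing `i` and a further element,
make the complement of `{i, j}` an obstruction. -/
theorem exists_isObstruction_of_card {G : Set (Finset σ)} {α β : Finset σ}
    (hα : IsMinimalCover G α) (hα' : α.card = 1) (hβ : IsMinimalCover G β) (hβ' : 1 < β.card) :
    ∃ T, IsObstruction G T := by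
  classical
  obtain ⟨j, rfl⟩ := Finset.card_eq_one.1 hα'
  obtain ⟨i, hi⟩ := Finset.card_pos.1 (by omega : 0 < β.card)
  have hcov : ∀ γ, IsMinimalCover G γ → j ∈ γ → γ = {j} := fun γ hγ hj =>
    (hα.eq_of_subset hγ (Finset.singleton_subset_iff.2 hj)).symm
  refine ⟨Finset.univ.filter fun l => l ≠ i ∧ l ≠ j, ⟨i, ⟨β, hβ, hi⟩, by simp, ?_⟩,
    {j}, hα, by simp⟩
  intro γ hγ hiγ
  by_contra! hc
  have hji : j ∉ γ := fun hj => by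
    have h1 := hcov γ hγ hj
    have : i = j := by simpa [h1] using hiγ
    have := hcov β hβ (this ▸ hi)
    simp [this] at hβ'
  have hγ' : γ = {i} := by
    refine Finset.eq_singleton_iff_unique_mem.2 ⟨hiγ, fun l hl => ?_⟩
    by_contra hli
    have := hc l hl
    simp only [Finset.mem_filter, Finset.mem_univ, true_and, not_and, not_not] at this
    exact hji (this hli ▸ hl)
  have := hγ.eq_of_subset hβ (by rw [hγ']; exact Finset.singleton_subset_iff.2 hi)
  rw [← this, hγ'] at hβ'
  simp at hβ'

end Combinatorics

/-! ### Monomial ideals of power series rings -/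

section MonomialIdeals

open MvPowerSeries

variable {σ : Type*} {k : Type u} [Field k]

/-- A power series lies in an ideal generated by finitely many monomials as soon as each of its
monomials does. The tail of the series is distributed over the generators by a choice function. -/
theorem mem_span_monomial_of_forall {τ : Type*} [Finite τ] (γ : τ → σ →₀ ℕ)
    {J : Ideal (MvPowerSeries σ k)} (hJ : ∀ t, monomial (γ t) (1 : k) ∈ J) {f : MvPowerSeries σ k}
    (hf : ∀ a, coeff a f ≠ 0 → ∃ t, γ t ≤ a) : f ∈ J := by
  classical
  have := Fintype.ofFinite τ
  let c : (σ →₀ ℕ) → Option τ := fun a => if h : ∃ t, γ t ≤ a then some h.choose else none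
  let h : τ → MvPowerSeries σ k := fun t a => if c (a + γ t) = some t then coeff (a + γ t) f else 0
  have key : f = ∑ t, monomial (γ t) (1 : k) * h t := by
    ext a
    simp only [map_sum, coeff_monomial_mul, one_mul]
    by_cases ha : ∃ t, γ t ≤ a
    · have hca : c a = some ha.choose := dif_pos ha
      rw [Finset.sum_eq_single ha.choose]
      · rw [if_pos ha.choose_spec]
        change _ = if c (a - γ ha.choose + γ ha.choose) = some ha.choose then _ else _
        rw [tsub_add_cancel_of_le ha.choose_spec, if_pos hca]
      · intro t _ ht
        split_ifs with hta
        · change (if c (a - γ t + γ t) = some t then _ else _) = _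
          rw [tsub_add_cancel_of_le hta, if_neg]
          rw [hca]
          exact fun hc => ht (Option.some.inj hc).symm
        · rfl
      · simp
    · rw [Finset.sum_eq_zero]
      · by_contra hc
        exact ha (hf a hc)
      · intro t _
        rw [if_neg fun h => ha ⟨t, h⟩]
  rw [key]
  exact J.sum_mem fun t _ => J.mul_mem_right _ (hJ t)

/-- The power series all of whose monomials have exponents in an upper set. Every ideal
generated by monomials has this form. -/
def exponentIdeal (k : Type u) [Field k] (U : Set (σ →₀ ℕ)) (hU : IsUpperSet U) :
    Ideal (MvPowerSeries σ k) where
  carrier := {f | ∀ a, coeff a f ≠ 0 → a ∈ U}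
  zero_mem' a ha := (ha (map_zero _)).elim
  add_mem' {f g} hf hg a ha := by
    by_contra h
    refine ha ?_
    rw [map_add, not_imp_comm.1 (hf a) h, not_imp_comm.1 (hg a) h, add_zero]
  smul_mem' s f hf a ha := by
    classical
    rw [smul_eq_mul, coeff_mul] at ha
    obtain ⟨x, hx, hne⟩ := Finset.exists_ne_zero_of_sum_ne_zero ha
    refine hU ?_ (hf x.2 (right_ne_zero_of_mul hne))
    rw [← Finset.HasAntidiagonal.mem_antidiagonal.1 hx]
    exact le_add_self

theorem monomial_mem_exponentIdeal {U : Set (σ →₀ ℕ)} {hU : IsUpperSet U} {a : σ →₀ ℕ} :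
    monomial a (1 : k) ∈ exponentIdeal k U hU ↔ a ∈ U := by
  classical
  refine ⟨fun h => h a (by simp), fun h b hb => ?_⟩
  rw [coeff_monomial] at hb
  have : b = a := by
    by_contra hc
    simp [hc] at hb
  exact this ▸ h

/-- The support of a product is contained in the sum of the supports. -/
theorem exists_add_of_coeff_mul_ne_zero {f g : MvPowerSeries σ k} {a : σ →₀ ℕ}
    (h : coeff a (f * g) ≠ 0) : ∃ b c, b + c = a ∧ coeff b f ≠ 0 ∧ coeff c g ≠ 0 := by
  classical
  rw [coeff_mul] at h
  obtain ⟨x, hx, hne⟩ := Finset.exists_ne_zero_of_sum_ne_zero h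
  exact ⟨x.1, x.2, Finset.HasAntidiagonal.mem_antidiagonal.1 hx, left_ne_zero_of_mul hne,
    right_ne_zero_of_mul hne⟩

section Frobenius

variable (p : ℕ) [Fact p.Prime] [CharP k p]

/-- Coefficientwise, the `q`-th power is the Frobenius of the field on the exponents `q a`. -/
theorem coeff_nsmul_pow (e : ℕ) (f : MvPowerSeries σ k) (a : σ →₀ ℕ) :
    coeff (p ^ e • a) (f ^ p ^ e) = coeff a f ^ p ^ e := by
  have hp : p ≠ 0 := (Fact.out : p.Prime).ne_zero
  rw [← map_iterateFrobenius_expand p hp, coeff_map, coeff_expand_smul, iterateFrobenius_def]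

theorem exists_nsmul_of_coeff_pow_ne_zero {e : ℕ} {f : MvPowerSeries σ k} {a : σ →₀ ℕ}
    (h : coeff a (f ^ p ^ e) ≠ 0) : ∃ b, a = p ^ e • b ∧ coeff b f ≠ 0 := by
  have hp : p ≠ 0 := (Fact.out : p.Prime).ne_zero
  have hdvd : ∀ i, p ^ e ∣ a i := by
    intro i
    by_contra hc
    rw [← map_iterateFrobenius_expand p hp, coeff_map, coeff_expand_of_not_dvd _ _ _ hc,
      map_zero] at h
    exact h rfl
  have hb : a = p ^ e • a.mapRange (fun n => n / p ^ e) (Nat.zero_div _) := by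
    ext i
    simp [Nat.mul_div_cancel' (hdvd i)]
  refine ⟨_, hb, fun h0 => h ?_⟩
  rw [hb, coeff_nsmul_pow, h0, zero_pow (pow_ne_zero _ hp)]

end Frobenius

theorem isUpperSet_monomialExponents (G : Set (Finset σ)) (q : ℕ) :
    IsUpperSet (monomialExponents G q) := fun _ _ => monomialExponents_mono

theorem isUpperSet_colonExponents (G : Set (Finset σ)) (q : ℕ) :
    IsUpperSet (colonExponents G q) := fun _ _ => colonExponents_mono

theorem prod_X_pow_eq_monomial (g : Finset σ) (q : ℕ) :
    (∏ i ∈ g, (X i : MvPowerSeries σ k)) ^ q = monomial (∑ i ∈ g, Finsupp.single i q) 1 := by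
  classical
  induction g using Finset.induction_on with
  | empty => simp
  | insert i g hi ih =>
    rw [Finset.prod_insert hi, mul_pow, ih, X_pow_eq, monomial_mul_monomial,
      Finset.sum_insert hi, one_mul]

theorem sum_single_apply [DecidableEq σ] (g : Finset σ) (q : ℕ) (i : σ) :
    (∑ j ∈ g, Finsupp.single j q) i = if i ∈ g then q else 0 := by
  simp [Finsupp.finsetSum_apply, Finsupp.single_apply]

theorem sum_single_le_iff {g : Finset σ} {q : ℕ} {a : σ →₀ ℕ} :
    ∑ j ∈ g, Finsupp.single j q ≤ a ↔ ∀ i ∈ g, q ≤ a i := by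
  classical
  rw [Finsupp.le_def]
  refine forall_congr' fun i => ?_
  rw [sum_single_apply]
  split_ifs with h <;> simp [h]

theorem colon_exponentIdeal (G : Set (Finset σ)) (q : ℕ) :
    (exponentIdeal k _ (isUpperSet_monomialExponents G q)).colon
        (exponentIdeal k _ (isUpperSet_monomialExponents G 1) : Set (MvPowerSeries σ k)) =
      exponentIdeal k _ (isUpperSet_colonExponents G q) := by
  ext f
  rw [Submodule.mem_colon]
  constructor
  · intro h a ha c hc
    refine h (monomial c 1) (monomial_mem_exponentIdeal.2 hc) (a + c) ?_
    rwa [smul_eq_mul, coeff_add_mul_monomial, mul_one]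
  · intro h g hg a ha
    obtain ⟨b, c, rfl, hb, hc⟩ := exists_add_of_coeff_mul_ne_zero ha
    exact h b hb c (hg c hc)

variable [Finite σ]

/-- An ideal lying between the ideal spanned by the monomials `(∏_{i ∈ g} xᵢ) ^ q` and the ideal of
series supported on their multiples is the latter. -/
theorem eq_exponentIdeal_of_le {G : Set (Finset σ)} {q : ℕ} {J : Ideal (MvPowerSeries σ k)}
    (h : ∀ g ∈ G, (∏ i ∈ g, (X i : MvPowerSeries σ k)) ^ q ∈ J)
    (h' : J ≤ exponentIdeal k _ (isUpperSet_monomialExponents G q)) :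
    J = exponentIdeal k _ (isUpperSet_monomialExponents G q) := by
  refine le_antisymm h' fun f hf => ?_
  refine mem_span_monomial_of_forall (fun g : G => ∑ i ∈ g.1, Finsupp.single i q) (fun g => ?_)
    fun a ha => ?_
  · rw [← prod_X_pow_eq_monomial]
    exact h g.1 g.2
  · obtain ⟨g, hg, hga⟩ := hf a ha
    exact ⟨⟨g, hg⟩, sum_single_le_iff.2 hga⟩

theorem span_prod_X_eq (G : Set (Finset σ)) :
    Ideal.span ((fun g : Finset σ => ∏ i ∈ g, (X i : MvPowerSeries σ k)) '' G) =
      exponentIdeal k _ (isUpperSet_monomialExponents G 1) := by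
  refine eq_exponentIdeal_of_le (fun g hg => ?_) (Ideal.span_le.2 ?_)
  · rw [pow_one]
    exact Ideal.subset_span ⟨g, hg, rfl⟩
  · rintro _ ⟨g, hg, rfl⟩
    change ∏ i ∈ g, (X i : MvPowerSeries σ k) ∈ _
    rw [← pow_one (∏ i ∈ g, _), prod_X_pow_eq_monomial]
    exact monomial_mem_exponentIdeal.2 ⟨g, hg, sum_single_le_iff.1 le_rfl⟩

theorem frobeniusPower_exponentIdeal (p : ℕ) [Fact p.Prime] [CharP k p] (G : Set (Finset σ))
    (e : ℕ) :
    frobeniusPower (exponentIdeal k _ (isUpperSet_monomialExponents G 1)) (p ^ e) =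
      exponentIdeal k _ (isUpperSet_monomialExponents G (p ^ e)) := by
  refine eq_exponentIdeal_of_le (fun g hg => ?_) (Ideal.span_le.2 ?_)
  · refine Ideal.subset_span ⟨_, ?_, rfl⟩
    rw [← pow_one (∏ i ∈ g, _), prod_X_pow_eq_monomial]
    exact monomial_mem_exponentIdeal.2 ⟨g, hg, sum_single_le_iff.1 le_rfl⟩
  · rintro _ ⟨f, hf, rfl⟩ a ha
    obtain ⟨b, rfl, hb⟩ := exists_nsmul_of_coeff_pow_ne_zero p ha
    obtain ⟨g, hg, hgb⟩ := hf b hb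
    exact ⟨g, hg, fun i hi => by simpa using Nat.le_mul_of_pos_right _ (hgb i hi)⟩

end MonomialIdeals

/-! ### Inverse polynomials -/

noncomputable section InversePolynomials

open MvPowerSeries Finset.HasAntidiagonal

/-- The inverse polynomials over `k`. The basis vector `single a 1` is the inverse monomial `x^{-a}`,
and power series act by contraction: `x^b x^{-a}` is `x^{-(a-b)}` if `b ≤ a`, and zero otherwise. -/
abbrev InversePolynomial (σ : Type) (k : Type u) [Field k] : Type u := (σ →₀ ℕ) →₀ k

namespace InversePolynomial

variable {σ : Type} {k : Type u} [Field k]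

/-- Contraction of inverse polynomials with the power series `s`. -/
def contract (s : MvPowerSeries σ k) : Module.End k (InversePolynomial σ k) :=
  letI := Classical.decEq σ
  Finsupp.lsum k fun a => ∑ x ∈ antidiagonal a, coeff x.1 s • Finsupp.lsingle x.2

theorem contract_single [DecidableEq σ] (s : MvPowerSeries σ k) (a : σ →₀ ℕ) (c : k) :
    contract s (Finsupp.single a c) =
      ∑ x ∈ antidiagonal a, Finsupp.single x.2 (coeff x.1 s * c) := by
  rw [contract, Finsupp.lsum_single, LinearMap.sum_apply]
  simp only [LinearMap.smul_apply, Finsupp.lsingle_apply, Finsupp.smul_single, smul_eq_mul]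
  convert rfl

/-- Contraction, as a ring homomorphism. -/
def contractHom : MvPowerSeries σ k →+* Module.End k (InversePolynomial σ k) where
  toFun := contract
  map_one' := by
    classical
    refine Finsupp.lhom_ext fun a c => ?_
    rw [contract_single, Finset.sum_eq_single (0, a)]
    · simp
    · rintro ⟨x, y⟩ hx hne
      rw [mem_antidiagonal] at hx
      dsimp only at hx ⊢
      rw [coeff_one, if_neg, zero_mul, Finsupp.single_zero]
      rintro rfl
      exact hne (by rw [← hx, zero_add])
    · simp
  map_mul' s t := by
    classical
    refine Finsupp.lhom_ext fun a c => ?_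
    rw [Module.End.mul_apply, contract_single, contract_single, map_sum]
    simp only [contract_single, coeff_mul, Finset.sum_mul, Finsupp.single_finsetSum,
      Finset.sum_sigma']
    refine Finset.sum_nbij' (fun x => ⟨(x.2.2, x.2.1 + x.1.2), (x.2.1, x.1.2)⟩)
      (fun x => ⟨(x.2.1 + x.1.1, x.2.2), (x.2.1, x.1.1)⟩) ?_ ?_ ?_ ?_ ?_
    · rintro ⟨⟨u, y⟩, ⟨i, j⟩⟩ h
      simp only [Finset.mem_sigma, mem_antidiagonal] at h ⊢
      exact ⟨by rw [← h.1, ← h.2]; abel, trivial⟩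
    · rintro ⟨⟨u, y⟩, ⟨i, j⟩⟩ h
      simp only [Finset.mem_sigma, mem_antidiagonal] at h ⊢
      exact ⟨by rw [← h.1, ← h.2]; abel, trivial⟩
    · rintro ⟨⟨u, y⟩, ⟨i, j⟩⟩ h
      simp only [Finset.mem_sigma, mem_antidiagonal] at h
      obtain ⟨-, rfl⟩ := h
      rfl
    · rintro ⟨⟨u, y⟩, ⟨i, j⟩⟩ h
      simp only [Finset.mem_sigma, mem_antidiagonal] at h
      obtain ⟨-, rfl⟩ := h
      rfl
    · intro x _
      rw [mul_assoc]
  map_zero' := by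
    classical
    refine Finsupp.lhom_ext fun a c => ?_
    simp [contract_single]
  map_add' s t := by
    classical
    refine Finsupp.lhom_ext fun a c => ?_
    simp [contract_single, add_mul, Finset.sum_add_distrib]

instance module : Module (MvPowerSeries σ k) (InversePolynomial σ k) :=
  Module.compHom _ contractHom

theorem smul_eq (s : MvPowerSeries σ k) (f : InversePolynomial σ k) : s • f = contract s f := rfl

theorem smul_single_apply (s : MvPowerSeries σ k) (a b : σ →₀ ℕ) (c : k) [Decidable (b ≤ a)] :
    (s • (Finsupp.single a c : InversePolynomial σ k)) b =
      if b ≤ a then coeff (a - b) s * c else 0 := by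
  classical
  rw [smul_eq, contract_single, Finsupp.finsetSum_apply]
  split_ifs with h
  · rw [Finset.sum_eq_single (a - b, b)]
    · simp
    · rintro ⟨x, y⟩ hx hne
      rw [mem_antidiagonal] at hx
      dsimp only at hx ⊢
      rw [Finsupp.single_apply, if_neg]
      rintro rfl
      exact hne (by rw [← hx, add_tsub_cancel_right])
    · intro hn
      exact absurd (mem_antidiagonal.2 (tsub_add_cancel_of_le h)) hn
  · refine Finset.sum_eq_zero ?_
    rintro ⟨x, y⟩ hx
    rw [mem_antidiagonal] at hx
    dsimp only at hx ⊢
    rw [Finsupp.single_apply, if_neg]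
    rintro rfl
    exact h (hx ▸ le_add_self)

theorem monomial_smul_apply (b : σ →₀ ℕ) (x : k) (f : InversePolynomial σ k) (c : σ →₀ ℕ) :
    (monomial b x • f) c = x * f (b + c) := by
  classical
  induction f using Finsupp.induction_linear with
  | zero => simp
  | add f g hf hg => rw [smul_add, Finsupp.add_apply, hf, hg, Finsupp.add_apply, mul_add]
  | single a y =>
    rw [smul_single_apply, Finsupp.single_apply]
    by_cases h : c ≤ a
    · rw [if_pos h, coeff_monomial]
      by_cases hb : a - c = b
      · rw [if_pos hb, if_pos]
        rw [← hb, tsub_add_cancel_of_le h]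
      · rw [if_neg hb, if_neg, zero_mul, mul_zero]
        rintro rfl
        exact hb (by simp)
    · rw [if_neg h, if_neg, mul_zero]
      rintro rfl
      exact h le_add_self

theorem C_smul (x : k) (f : InversePolynomial σ k) : (C x : MvPowerSeries σ k) • f = x • f := by
  ext c
  rw [← monomial_zero_eq_C_apply, monomial_smul_apply, zero_add, Finsupp.smul_apply, smul_eq_mul]

instance : IsScalarTower k (MvPowerSeries σ k) (InversePolynomial σ k) where
  smul_assoc x s f := by
    rw [MvPowerSeries.smul_eq_C_mul, mul_smul, C_smul]

/-- Coefficientwise, contraction is the pairing of `s` with a shift of `f`. -/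
theorem smul_apply (s : MvPowerSeries σ k) (f : InversePolynomial σ k) (b : σ →₀ ℕ) :
    (s • f) b = f.sum fun a c => coeff a (monomial b 1 * s) * c := by
  classical
  induction f using Finsupp.induction_linear with
  | zero => simp
  | add f g hf hg =>
    rw [smul_add, Finsupp.add_apply, hf, hg, Finsupp.sum_add_index'] <;> simp [mul_add]
  | single a y =>
    rw [smul_single_apply, Finsupp.sum_single_index (by simp), coeff_monomial_mul]
    split_ifs <;> simp

theorem smul_apply_zero (s : MvPowerSeries σ k) (f : InversePolynomial σ k) :
    (s • f) 0 = f.sum fun a c => coeff a s * c := by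
  rw [smul_apply]
  simp

theorem smul_apply_eq_mul_smul_apply_zero (s : MvPowerSeries σ k) (f : InversePolynomial σ k)
    (b : σ →₀ ℕ) : (s • f) b = ((monomial b 1 * s) • f) 0 := by
  rw [smul_apply, smul_apply_zero]

/-- The annihilator of a monomial ideal is spanned by the inverse monomials outside of the ideal. -/
theorem forall_smul_eq_zero_iff {U : Set (σ →₀ ℕ)} {hU : IsUpperSet U}
    {f : InversePolynomial σ k} :
    (∀ s ∈ exponentIdeal k U hU, s • f = 0) ↔ ∀ a ∈ U, f a = 0 := by
  constructor
  · intro h a ha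
    have := DFunLike.congr_fun (h _ (monomial_mem_exponentIdeal.2 ha)) 0
    simpa [monomial_smul_apply] using this
  · intro h s hs
    ext b
    rw [smul_apply]
    refine Finset.sum_eq_zero fun a _ => ?_
    by_cases ha : a ∈ U
    · simp [h a ha]
    · have : coeff a (monomial b 1 * s) = 0 := by
        by_contra hc
        exact ha (Ideal.mul_mem_left _ (monomial b 1) hs a hc)
      simp [this]

end InversePolynomial
end InversePolynomials

/-! ### Injective hulls of the residue field -/

section InjectiveHulls

/-- An injective module in which every nonzero element has a multiple equal to a fixed socle element
is an injective hull of the residue field. -/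
theorem isInjectiveHullOfResidueField_of_socle {R : Type u} [CommRing R] [IsLocalRing R]
    {E : Type u} [AddCommGroup E] [Module R E] (hinj : Module.Injective R E) {z : E} (hz : z ≠ 0)
    (hmz : ∀ r ∈ IsLocalRing.maximalIdeal R, r • z = 0) (h : ∀ x : E, x ≠ 0 → ∃ r : R, r • x = z) :
    IsInjectiveHullOfResidueField R E := by
  have hle : IsLocalRing.maximalIdeal R ≤ LinearMap.ker (LinearMap.toSpanSingleton R E z) :=
    fun r hr => by simpa using hmz r hr
  refine ⟨hinj, (IsLocalRing.maximalIdeal R).liftQ (LinearMap.toSpanSingleton R E z) hle, ?_, ?_⟩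
  · refine LinearMap.ker_eq_bot.1 (Submodule.ker_liftQ_eq_bot _ _ _ fun r hr => ?_)
    by_contra hc
    have hu : IsUnit r := by
      by_contra hu
      exact hc ((IsLocalRing.mem_maximalIdeal r).2 hu)
    have hr' : r • z = 0 := by simpa using hr
    exact hz ((hu.smul_eq_zero).1 hr')
  · intro N hN
    by_contra hne
    obtain ⟨x, hx, hx0⟩ := Submodule.exists_mem_ne_zero_of_ne_bot hne
    obtain ⟨r, hr⟩ := h x hx0
    have hzN : z ∈ N := hr ▸ N.smul_mem r hx
    refine hz ((Submodule.eq_bot_iff _).1 hN z ⟨hzN, ?_⟩)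
    exact ⟨Submodule.Quotient.mk 1, (Submodule.liftQ_apply _ _ _).trans (one_smul R z)⟩

/-- Injective hulls of the residue field are unique up to isomorphism. -/
theorem IsInjectiveHullOfResidueField.nonempty_linearEquiv {R : Type u} [CommRing R]
    [IsLocalRing R] {E E' : Type u} [AddCommGroup E] [Module R E] [AddCommGroup E'] [Module R E']
    (hE : IsInjectiveHullOfResidueField R E) (hE' : IsInjectiveHullOfResidueField R E') :
    Nonempty (E ≃ₗ[R] E') := by
  obtain ⟨hi, j, hj, hess⟩ := hE
  obtain ⟨hi', j', hj', hess'⟩ := hE'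
  obtain ⟨f, hf⟩ := hi'.out j hj j'
  have hfinj : Function.Injective f := by
    refine LinearMap.ker_eq_bot.1 (hess _ ((Submodule.eq_bot_iff _).2 ?_))
    rintro _ ⟨hx, y, rfl⟩
    have : j' y = j' 0 := by rw [← hf, map_zero]; exact hx
    rw [hj' this, map_zero]
  obtain ⟨r, hr⟩ := hi.out f hfinj LinearMap.id
  have hrinj : Function.Injective r := by
    refine LinearMap.ker_eq_bot.1 (hess' _ ((Submodule.eq_bot_iff _).2 ?_))
    rintro _ ⟨hx, y, rfl⟩
    have h0 : r (f (j y)) = 0 := by rw [hf]; exact hx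
    rw [hr] at h0
    rw [← hf]
    simpa using congrArg f h0
  exact ⟨LinearEquiv.ofBijective f ⟨hfinj, fun y => ⟨r y, hrinj (hr (r y))⟩⟩⟩

/-- The annihilator of `I` in an injective `S`-module is an injective `S ⧸ I`-module. -/
theorem Module.Baer.of_quotient {S : Type*} [CommRing S] {I : Ideal S} {D M : Type*}
    [AddCommGroup D] [Module S D] [AddCommGroup M] [Module (S ⧸ I) M] (hD : Module.Baer S D)
    (ι : M →+ D) (hι : Function.Injective ι)
    (hsmul : ∀ (s : S) (m : M), ι (Ideal.Quotient.mk I s • m) = s • ι m)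
    (hrange : ∀ y : D, (∀ a ∈ I, a • y = 0) → ∃ m, ι m = y) : Module.Baer (S ⧸ I) M := by
  intro J f
  let f' : J.comap (Ideal.Quotient.mk I) →ₗ[S] D :=
    { toFun := fun x => ι (f ⟨Ideal.Quotient.mk I x.1, x.2⟩)
      map_add' := fun x y => by
        rw [← map_add, ← map_add]
        rfl
      map_smul' := fun s x => by
        rw [RingHom.id_apply, ← hsmul, ← map_smul]
        rfl }
  obtain ⟨g, hg⟩ := hD _ f'
  obtain ⟨m, hm⟩ := hrange (g 1) fun a ha => by
    have ha0 : Ideal.Quotient.mk I a = 0 := Ideal.Quotient.eq_zero_iff_mem.2 ha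
    have haJ : a ∈ J.comap (Ideal.Quotient.mk I) := by
      rw [Ideal.mem_comap, ha0]
      exact J.zero_mem
    rw [← map_smul, smul_eq_mul, mul_one, hg a haJ]
    change ι (f ⟨Ideal.Quotient.mk I a, haJ⟩) = 0
    have : (⟨Ideal.Quotient.mk I a, haJ⟩ : J) = 0 := Subtype.ext ha0
    rw [this, map_zero, map_zero]
  refine ⟨LinearMap.toSpanSingleton _ _ m, fun x hx => hι ?_⟩
  obtain ⟨s, rfl⟩ := Ideal.Quotient.mk_surjective x
  rw [LinearMap.toSpanSingleton_apply, hsmul, hm, ← map_smul, smul_eq_mul, mul_one, hg s hx]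
  rfl

end InjectiveHulls

noncomputable section

/-! ### Inverse polynomials as an injective hull -/

open MvPowerSeries

namespace InversePolynomial

variable {σ : Type} {k : Type u} [Field k]

theorem mem_maximalIdeal_iff {s : MvPowerSeries σ k} :
    s ∈ IsLocalRing.maximalIdeal (MvPowerSeries σ k) ↔ coeff 0 s = 0 := by
  rw [IsLocalRing.mem_maximalIdeal, mem_nonunits_iff, MvPowerSeries.isUnit_iff_constantCoeff,
    isUnit_iff_ne_zero, not_not, coeff_zero_eq_constantCoeff_apply]

theorem isUpperSet_degree (t : ℕ) : IsUpperSet {a : σ →₀ ℕ | t ≤ a.degree} :=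
  fun _ _ hab ha => le_trans (Set.mem_ofPred.1 ha) (Finsupp.degree_mono hab)

theorem maximalIdeal_pow_le (t : ℕ) : IsLocalRing.maximalIdeal (MvPowerSeries σ k) ^ t ≤
    exponentIdeal k _ (isUpperSet_degree t) := by
  induction t with
  | zero => exact fun s _ a _ => Nat.zero_le _
  | succ t ih =>
    rw [pow_succ]
    refine Ideal.mul_le.2 fun r hr s hs a ha => ?_
    obtain ⟨b, c, rfl, hb, hc⟩ := exists_add_of_coeff_mul_ne_zero ha
    have h1 : t ≤ b.degree := ih hr b hb
    have h2 : c ≠ 0 := by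
      rintro rfl
      exact hc (mem_maximalIdeal_iff.1 hs)
    have h3 : c.degree ≠ 0 := fun h => h2 ((Finsupp.degree_eq_zero_iff c).1 h)
    rw [Set.mem_ofPred, map_add]
    omega

/-- Every inverse polynomial is killed by a power of the maximal ideal. -/
theorem exists_maximalIdeal_pow_smul_eq_zero (f : InversePolynomial σ k) :
    ∃ t, ∀ s ∈ IsLocalRing.maximalIdeal (MvPowerSeries σ k) ^ t, s • f = 0 := by
  refine ⟨f.support.sup Finsupp.degree + 1, fun s hs => ?_⟩
  refine forall_smul_eq_zero_iff.2 (fun a ha => ?_) s (maximalIdeal_pow_le _ hs)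
  by_contra hc
  have := Finset.le_sup (f := Finsupp.degree) (Finsupp.mem_support_iff.2 hc)
  have ha' := Set.mem_ofPred.1 ha
  omega

theorem exists_smul_eq_single {f : InversePolynomial σ k} (hf : f ≠ 0) :
    ∃ s : MvPowerSeries σ k, s • f = Finsupp.single 0 1 := by
  classical
  obtain ⟨a, ha, hmax⟩ := Finset.exists_max_image f.support Finsupp.degree
    (Finsupp.support_nonempty_iff.2 hf)
  refine ⟨monomial a (f a)⁻¹, ?_⟩
  ext c
  rw [monomial_smul_apply, Finsupp.single_apply]
  split_ifs with hc
  · rw [← hc, add_zero, inv_mul_cancel₀ (Finsupp.mem_support_iff.1 ha)]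
  · have : f (a + c) = 0 := by
      by_contra hne
      have h1 := hmax _ (Finsupp.mem_support_iff.2 hne)
      rw [map_add] at h1
      exact hc ((Finsupp.degree_eq_zero_iff c).1 (by omega)).symm
    rw [this, mul_zero]

theorem smul_single_zero_eq_zero {s : MvPowerSeries σ k} (hs : coeff 0 s = 0) (c : k) :
    s • (Finsupp.single 0 c : InversePolynomial σ k) = 0 := by
  classical
  ext b
  rw [smul_single_apply]
  split_ifs with h
  · simp [hs]
  · rfl

/-- The exponents of the monomials in `(x₁^N, …, xₙ^N)` form an upper set. -/
theorem isUpperSet_exists_le (N : ℕ) : IsUpperSet {a : σ →₀ ℕ | ∃ i, N ≤ a i} :=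
  fun _ _ hab ⟨i, hi⟩ => ⟨i, hi.trans (hab i)⟩

variable [Finite σ]

theorem exponentIdeal_le_maximalIdeal_pow (N : ℕ) :
    exponentIdeal k _ (isUpperSet_exists_le N) ≤
      IsLocalRing.maximalIdeal (MvPowerSeries σ k) ^ N := by
  intro f hf
  refine mem_span_monomial_of_forall (fun i : σ => Finsupp.single i N) (fun i => ?_) fun a ha => ?_
  · rw [← X_pow_eq]
    exact Ideal.pow_mem_pow (mem_maximalIdeal_iff.2 (by simp)) N
  · obtain ⟨i, hi⟩ := hf a ha
    exact ⟨i, Finsupp.single_le_iff.2 hi⟩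

/-- Macaulay duality: a functional vanishing on `(x₁^N, …, xₙ^N)` is the pairing with an inverse
polynomial. -/
theorem exists_forall_smul_apply_zero_eq (N : ℕ) (l : MvPowerSeries σ k →ₗ[k] k)
    (hl : ∀ s ∈ exponentIdeal k _ (isUpperSet_exists_le (σ := σ) N), l s = 0) :
    ∃ h : InversePolynomial σ k, ∀ s : MvPowerSeries σ k, (s • h) 0 = l s := by
  classical
  have hfin : {a : σ →₀ ℕ | ∀ i, a i < N}.Finite := by
    refine (Set.finite_Iic (Finsupp.equivFunOnFinite.symm fun _ : σ => N)).subset fun a ha i => ?_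
    exact (ha i).le
  let h : InversePolynomial σ k := Finsupp.onFinset hfin.toFinset
    (fun a => l (monomial a 1)) fun a ha => by
      rw [Set.Finite.mem_toFinset]
      by_contra hc
      refine ha (hl _ (monomial_mem_exponentIdeal.2 ?_))
      simpa using hc
  refine ⟨h, fun s => ?_⟩
  have hs : l s = l (∑ a ∈ hfin.toFinset, monomial a (coeff a s)) := by
    rw [← sub_eq_zero, ← map_sub]
    refine hl _ fun b hb => ?_
    by_contra hc
    refine hb ?_
    have hb' : b ∈ hfin.toFinset := by
      rw [Set.Finite.mem_toFinset]
      simpa using hc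
    simp [map_sum, coeff_monomial, hb']
  rw [smul_apply_zero, hs, map_sum, Finsupp.onFinset_sum _ (by simp)]
  refine Finset.sum_congr rfl fun a _ => ?_
  have : monomial a (coeff a s) = coeff a s • monomial a (1 : k) := by
    rw [← map_smul, smul_eq_mul, mul_one]
  rw [this, map_smul, smul_eq_mul]

/-- The inverse polynomials are an injective module. Given `f` on an ideal `J`, the Artin-Rees lemma
shows that `f` vanishes on `J ∩ (x₁^N, …, xₙ^N)` for some `N`. So the functional `s ↦ f(s)₀` on `J`
extends to one on the whole ring vanishing on `(x₁^N, …, xₙ^N)`, and the dual inverse polynomial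
represents `f`. -/
theorem baer : Module.Baer (MvPowerSeries σ k) (InversePolynomial σ k) := by
  intro J f
  set m := IsLocalRing.maximalIdeal (MvPowerSeries σ k)
  -- the image of `f` is killed by a power of the maximal ideal
  obtain ⟨t, ht⟩ : ∃ t, ∀ s ∈ m ^ t, ∀ x, s • f x = 0 := by
    obtain ⟨F, hF⟩ := (Module.Finite.fg_top : (⊤ : Submodule (MvPowerSeries σ k) J).FG)
    choose t ht using fun x => exists_maximalIdeal_pow_smul_eq_zero (f x)
    refine ⟨F.sup t, fun s hs x => ?_⟩
    have hx : x ∈ Submodule.span (MvPowerSeries σ k) (F : Set J) := hF ▸ Submodule.mem_top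
    induction hx using Submodule.span_induction with
    | mem x hx => exact ht x s (Ideal.pow_le_pow_right (Finset.le_sup (f := t) hx) hs)
    | zero => simp
    | add x y _ _ hx hy => rw [map_add, smul_add, hx, hy, add_zero]
    | smul r x _ hx => rw [map_smul, smul_comm, hx, smul_zero]
  -- by Artin-Rees `f` vanishes on `J ∩ 𝔪 ^ N`
  obtain ⟨K, hK⟩ := Ideal.exists_pow_inf_eq_pow_smul m (J : Submodule _ (MvPowerSeries σ k))
  have hf0 : ∀ x : J, x.1 ∈ m ^ (K + t) → f x = 0 := by
    have hker : m ^ t • J ≤ (LinearMap.ker f).map J.subtype := by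
      refine Submodule.smul_le.2 fun r hr x hx => ?_
      exact ⟨r • ⟨x, hx⟩, by
        rw [SetLike.mem_coe, LinearMap.mem_ker, map_smul]
        exact ht r hr ⟨x, hx⟩, rfl⟩
    intro x hx
    have h1 : x.1 ∈ m ^ (K + t) • (⊤ : Submodule _ (MvPowerSeries σ k)) ⊓ J := by
      refine ⟨?_, x.2⟩
      simpa using hx
    rw [hK (K + t) (Nat.le_add_right _ _), Nat.add_sub_cancel_left] at h1
    obtain ⟨y, hy, hyx⟩ := hker (Submodule.smul_mono le_rfl inf_le_right h1)
    have : y = x := Subtype.ext hyx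
    exact this ▸ hy
  let W := (exponentIdeal k _ (isUpperSet_exists_le (σ := σ) (K + t))).restrictScalars k
  let ε : InversePolynomial σ k →ₗ[k] k := Finsupp.lapply 0
  let lJ : J →ₗ[k] k := ε ∘ₗ f.restrictScalars k
  let g : J →ₗ[k] MvPowerSeries σ k ⧸ W := W.mkQ ∘ₗ J.subtype.restrictScalars k
  obtain ⟨μ, hμ⟩ : lJ ∈ LinearMap.range g.dualMap := by
    rw [LinearMap.range_dualMap_eq_dualAnnihilator_ker, Submodule.mem_dualAnnihilator]
    intro x hx
    have hxW : x.1 ∈ W := by simpa [g] using hx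
    change (f x) 0 = 0
    rw [hf0 x (exponentIdeal_le_maximalIdeal_pow _ hxW)]
    rfl
  obtain ⟨h, hh⟩ := exists_forall_smul_apply_zero_eq (K + t) (μ ∘ₗ W.mkQ) fun s hs => by
    have : W.mkQ s = 0 := (Submodule.Quotient.mk_eq_zero W).2 hs
    rw [LinearMap.comp_apply, this, map_zero]
  refine ⟨LinearMap.toSpanSingleton _ _ h, fun x hx => ?_⟩
  ext b
  rw [LinearMap.toSpanSingleton_apply, smul_apply_eq_mul_smul_apply_zero, hh]
  have h1 : lJ (monomial b (1 : k) • ⟨x, hx⟩) = (f ⟨x, hx⟩) b := by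
    change (f (monomial b (1 : k) • ⟨x, hx⟩)) 0 = _
    rw [map_smul, monomial_smul_apply, one_mul, add_zero]
  rw [← h1, ← hμ]
  rfl

theorem isInjectiveHullOfResidueField :
    IsInjectiveHullOfResidueField (MvPowerSeries σ k) (InversePolynomial σ k) :=
  isInjectiveHullOfResidueField_of_socle baer.injective (z := Finsupp.single 0 1) (by simp)
    (fun _ hr => smul_single_zero_eq_zero (mem_maximalIdeal_iff.1 hr) 1)
    fun _ hx => exists_smul_eq_single hx

/-- Any injective hull of the residue field of `S ⧸ I` is identified with the annihilator of `I` in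
the inverse polynomials. -/
theorem exists_embedding {I : Ideal (MvPowerSeries σ k)} [Nontrivial (MvPowerSeries σ k ⧸ I)]
    {E : Type u} [AddCommGroup E] [Module (MvPowerSeries σ k ⧸ I) E]
    (hE : IsInjectiveHullOfResidueField (MvPowerSeries σ k ⧸ I) E) :
    ∃ ι : E →+ InversePolynomial σ k, Function.Injective ι ∧
      (∀ (s : MvPowerSeries σ k) (m : E), ι (Ideal.Quotient.mk I s • m) = s • ι m) ∧
      Set.range ι = {y | ∀ a ∈ I, a • y = 0} := by
  let M := Submodule.torsionBySet (MvPowerSeries σ k) (InversePolynomial σ k) I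
  have hM : ∀ y, y ∈ M ↔ ∀ a ∈ I, a • y = 0 := fun y => by
    rw [Submodule.mem_torsionBySet_iff]
    simp
  have hsmul : ∀ (s : MvPowerSeries σ k) (m : M),
      M.subtype.toAddMonoidHom (Ideal.Quotient.mk I s • m) = s • M.subtype.toAddMonoidHom m :=
    fun s m => rfl
  have hunit : ∀ s ∈ I, coeff 0 s = 0 := fun s hs => by
    rw [← mem_maximalIdeal_iff]
    exact IsLocalRing.le_maximalIdeal
      (Ideal.Quotient.nontrivial_iff.1 ‹Nontrivial (MvPowerSeries σ k ⧸ I)›) hs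
  have hMhull : IsInjectiveHullOfResidueField (MvPowerSeries σ k ⧸ I) M := by
    refine isInjectiveHullOfResidueField_of_socle
      (z := ⟨Finsupp.single 0 1, (hM _).2 fun s hs => smul_single_zero_eq_zero (hunit s hs) 1⟩)
      ?_ ?_ ?_ ?_
    · refine (Module.Baer.of_quotient baer M.subtype.toAddMonoidHom Subtype.val_injective hsmul
        fun y hy => ⟨⟨y, (hM y).2 hy⟩, rfl⟩).injective
    · intro hc
      have := congrArg Subtype.val hc
      simp at this
    · intro r hr
      obtain ⟨s, rfl⟩ := Ideal.Quotient.mk_surjective r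
      refine Subtype.ext (smul_single_zero_eq_zero (s := s) ?_ 1)
      rw [← mem_maximalIdeal_iff, IsLocalRing.mem_maximalIdeal]
      exact fun hu => hr (hu.map (Ideal.Quotient.mk I))
    · intro x hx
      obtain ⟨s, hs⟩ := exists_smul_eq_single (f := x.1) fun h => hx (Subtype.ext h)
      exact ⟨Ideal.Quotient.mk I s, Subtype.ext hs⟩
  obtain ⟨φ⟩ := hE.nonempty_linearEquiv hMhull
  refine ⟨M.subtype.toAddMonoidHom.comp φ.toLinearMap.toAddMonoidHom,
    Subtype.val_injective.comp φ.injective, fun s m => ?_, ?_⟩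
  · change ((φ (Ideal.Quotient.mk I s • m) : M) : InversePolynomial σ k) = s • (φ m).1
    rw [map_smul]
    rfl
  · ext y
    constructor
    · rintro ⟨x, rfl⟩
      exact (hM _).1 (φ x).2
    · intro hy
      exact ⟨φ.symm ⟨y, (hM y).2 hy⟩, by
        change ((φ (φ.symm _) : M) : InversePolynomial σ k) = y
        rw [LinearEquiv.apply_symm_apply]⟩

end InversePolynomial
end

noncomputable section

/-! ### The Frobenius action on inverse polynomials -/

open MvPowerSeries

namespace InversePolynomial

variable {σ : Type}

/-- The componentwise quotient `⌊b / q⌋`. -/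
def divExp (q : ℕ) (b : σ →₀ ℕ) : σ →₀ ℕ := b.mapRange (fun m => m / q) (Nat.zero_div q)

theorem divExp_apply (q : ℕ) (b : σ →₀ ℕ) (i : σ) : divExp q b i = b i / q := rfl

theorem divExp_mem_monomialExponents_iff {G : Set (Finset σ)} {q : ℕ} (hq : 0 < q) {b : σ →₀ ℕ} :
    divExp q b ∈ monomialExponents G 1 ↔ b ∈ monomialExponents G q := by
  refine exists_congr fun g => and_congr_right fun _ => forall₂_congr fun i _ => ?_
  rw [divExp_apply, Nat.one_le_div_iff hq]

variable [Finite σ]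

/-- The exponent of the `q`-th power of an inverse monomial. In the top local cohomology of the power
series ring, `single a 1` stands for `x^{-(a+1)}`, whose `q`-th power is `x^{-(q a + q - 1 + 1)}`. -/
def frobExp (q : ℕ) (a : σ →₀ ℕ) : σ →₀ ℕ :=
  Finsupp.equivFunOnFinite.symm fun i => q * a i + (q - 1)

theorem frobExp_apply (q : ℕ) (a : σ →₀ ℕ) (i : σ) : frobExp q a i = q * a i + (q - 1) := rfl

/-- `divExp q` is left adjoint to `frobExp q`. -/
theorem le_frobExp_iff {q : ℕ} (hq : 0 < q) {a b : σ →₀ ℕ} : b ≤ frobExp q a ↔ divExp q b ≤ a := by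
  refine forall_congr' fun i => ?_
  rw [frobExp_apply, divExp_apply]
  rw [← Nat.lt_add_one_iff (n := a i), Nat.div_lt_iff_lt_mul hq, add_mul, mul_comm (a i)]
  omega

theorem divExp_frobExp {q : ℕ} (hq : 0 < q) (a : σ →₀ ℕ) : divExp q (frobExp q a) = a := by
  ext i
  rw [divExp_apply, frobExp_apply, Nat.mul_add_div hq, Nat.div_eq_of_lt (by omega), add_zero]

theorem frobExp_injective {q : ℕ} (hq : 0 < q) :
    Function.Injective (frobExp q : (σ →₀ ℕ) → σ →₀ ℕ) :=
  Function.LeftInverse.injective (divExp_frobExp hq)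

variable {k : Type u} [Field k] (p : ℕ) [Fact p.Prime] [CharP k p]

/-- The `e`-fold iterate of the natural Frobenius action on the inverse polynomials. -/
def frob (e : ℕ) : AddMonoid.End (InversePolynomial σ k) :=
  (Finsupp.mapDomain.addMonoidHom (frobExp (p ^ e))).comp
    (Finsupp.mapRange.addMonoidHom (iterateFrobenius k p e).toAddMonoidHom)

theorem pow_prime_pos (p : ℕ) [Fact p.Prime] (e : ℕ) : 0 < p ^ e :=
  pow_pos (Fact.out : p.Prime).pos e

theorem frob_single (e : ℕ) (a : σ →₀ ℕ) (c : k) :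
    frob p e (Finsupp.single a c) = Finsupp.single (frobExp (p ^ e) a) (c ^ p ^ e) := by
  change Finsupp.mapDomain _ (Finsupp.mapRange (fun x => iterateFrobenius k p e x)
    (map_zero _) (Finsupp.single a c)) = _
  rw [Finsupp.mapRange_single, Finsupp.mapDomain_single, iterateFrobenius_def]

theorem frob_apply_frobExp (e : ℕ) (f : InversePolynomial σ k) (a : σ →₀ ℕ) :
    frob p e f (frobExp (p ^ e) a) = f a ^ p ^ e :=
  Finsupp.mapDomain_apply (frobExp_injective (pow_prime_pos p e)) _ a

theorem frob_apply_of_notMem_range (e : ℕ) (f : InversePolynomial σ k) {a : σ →₀ ℕ}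
    (ha : a ∉ Set.range (frobExp (σ := σ) (p ^ e))) : frob p e f a = 0 :=
  Finsupp.mapDomain_of_notMem_range _ a ha

theorem frob_one_pow (e : ℕ) :
    (frob p 1 : AddMonoid.End (InversePolynomial σ k)) ^ e = frob p e := by
  induction e with
  | zero =>
    refine DFunLike.ext _ _ fun f => ?_
    induction f using Finsupp.induction_linear with
    | zero => rw [map_zero, map_zero]
    | add f g hf hg => rw [map_add, map_add, hf, hg]
    | single a c =>
      rw [frob_single, pow_zero, pow_zero, pow_one]
      change Finsupp.single a c = _
      congr 1
      ext i
      simp [frobExp_apply]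
  | succ e ih =>
    refine DFunLike.ext _ _ fun f => ?_
    rw [pow_succ', ih]
    change frob p 1 (frob p e f) = _
    induction f using Finsupp.induction_linear with
    | zero => simp only [map_zero]
    | add f g hf hg => rw [map_add, map_add, map_add, hf, hg]
    | single a c =>
      rw [frob_single, frob_single, frob_single, ← pow_mul, ← pow_add]
      congr 1
      ext i
      have h1 := pow_prime_pos p e
      simp only [frobExp_apply, pow_one, pow_succ' p e]
      have := (Fact.out : p.Prime).pos
      have h2 : p * (p ^ e - 1) = p * p ^ e - p := by rw [Nat.mul_sub, mul_one]
      have h3 : p ≤ p * p ^ e := Nat.le_mul_of_pos_right _ h1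
      rw [mul_add, h2, mul_assoc]
      omega

theorem frob_smul (e : ℕ) (s : MvPowerSeries σ k) (f : InversePolynomial σ k) :
    frob p e (s • f) = s ^ p ^ e • frob p e f := by
  classical
  have hq := pow_prime_pos p e
  induction f using Finsupp.induction_linear with
  | zero => simp
  | add f g hf hg => rw [smul_add, map_add, hf, hg, map_add, smul_add]
  | single a c =>
    rw [frob_single]
    ext d
    rw [smul_single_apply]
    by_cases hd : d ∈ Set.range (frobExp (σ := σ) (p ^ e))
    · obtain ⟨b, rfl⟩ := hd
      simp only [frob_apply_frobExp, smul_single_apply, le_frobExp_iff hq, divExp_frobExp hq]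
      split_ifs with hba
      · rw [mul_pow, ← coeff_nsmul_pow]
        congr 3
        ext i
        have := hba i
        simp only [Finsupp.smul_apply, Finsupp.tsub_apply, smul_eq_mul, frobExp_apply, Nat.mul_sub]
        omega
      · rw [zero_pow hq.ne']
    · rw [frob_apply_of_notMem_range p e _ hd]
      split_ifs with hle
      · by_contra hne
        have hne' : coeff (frobExp (p ^ e) a - d) (s ^ p ^ e) ≠ 0 := by
          intro h
          rw [h, zero_mul] at hne
          exact hne rfl
        obtain ⟨b, hb, -⟩ := exists_nsmul_of_coeff_pow_ne_zero p hne'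
        refine hd ⟨a - b, ?_⟩
        ext i
        have h1 := DFunLike.congr_fun hb i
        have h2 := hle i
        simp only [Finsupp.smul_apply, Finsupp.tsub_apply, smul_eq_mul, frobExp_apply,
          Nat.mul_sub] at h1 h2 ⊢
        have h3 : b i ≤ a i := by
          by_contra! hlt
          have := Nat.mul_le_mul_left (p ^ e) (Nat.succ_le_of_lt hlt)
          rw [Nat.succ_eq_add_one, mul_add] at this
          omega
        have := Nat.mul_le_mul_left (p ^ e) h3
        omega
      · rfl

theorem smul_frob_apply (e : ℕ) (g : MvPowerSeries σ k) (f : InversePolynomial σ k) (c : σ →₀ ℕ)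
    [DecidableEq σ] :
    (g • frob p e f) c = f.sum fun a x =>
      if c ≤ frobExp (p ^ e) a then coeff (frobExp (p ^ e) a - c) g * x ^ p ^ e else 0 := by
  have hq := pow_prime_pos p e
  induction f using Finsupp.induction_linear with
  | zero => simp
  | add f g hf hg =>
    rw [map_add, smul_add, Finsupp.add_apply, hf, hg, Finsupp.sum_add_index']
    · intro a
      simp [zero_pow hq.ne']
    · intro a x y
      split_ifs
      · rw [add_pow_char_pow, mul_add]
      · rw [add_zero]
  | single a x =>
    rw [frob_single, smul_single_apply, Finsupp.sum_single_index]
    simp [zero_pow hq.ne']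

section Embedded

variable {E : Type v} [AddCommGroup E] {ι : E →+ InversePolynomial σ k} {U : Set (σ →₀ ℕ)}

/-- Every `q`-linear map from the annihilator of a monomial ideal to the inverse polynomials is of the
form `g θᵉ`. The map is determined by the images of the inverse monomials `x^{-a}`. In `g θᵉ x^{-a}`
the coefficient of `g` at `b` occurs for every `a ≥ ⌊b / q⌋`, and `q`-linearity makes the values that
it has to take for different `a` agree, so it is read off from `a = ⌊b / q⌋`. -/
theorem exists_forall_eq_smul_frob (hι : Function.Injective ι) (hU : IsUpperSet U)
    (hrange : Set.range ι = {y | ∀ a ∈ U, y a = 0}) (e : ℕ) (ψ : E →+ InversePolynomial σ k)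
    (hψ : ∀ (s : MvPowerSeries σ k) (m m' : E), ι m' = s • ι m → ψ m' = s ^ p ^ e • ψ m) :
    ∃ g : MvPowerSeries σ k, ∀ m, ψ m = g • frob p e (ι m) := by
  classical
  have hq := pow_prime_pos p e
  set q := p ^ e with hqe
  have hex : ∀ a c, ∃ m : E, a ∉ U → ι m = Finsupp.single a c := by
    intro a c
    by_cases ha : a ∈ U
    · exact ⟨0, fun h => (h ha).elim⟩
    · have : (Finsupp.single a c : InversePolynomial σ k) ∈ Set.range ι := by
        rw [hrange]
        intro b hb
        rw [Finsupp.single_apply, if_neg]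
        rintro rfl
        exact ha hb
      obtain ⟨m, hm⟩ := this
      exact ⟨m, fun _ => hm⟩
  choose y hy using hex
  let g : MvPowerSeries σ k := fun b =>
    if divExp q b ∈ U then 0 else ψ (y (divExp q b) 1) (frobExp q (divExp q b) - b)
  have hg : ∀ b, coeff b g =
      if divExp q b ∈ U then 0 else ψ (y (divExp q b) 1) (frobExp q (divExp q b) - b) :=
    fun b => rfl
  have key : ∀ a, a ∉ U → ψ (y a 1) = g • Finsupp.single (frobExp q a) (1 : k) := by
    intro a ha
    ext c
    rw [smul_single_apply]
    split_ifs with hc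
    · set b := frobExp q a - c with hb
      have hba : divExp q b ≤ a := (le_frobExp_iff hq).1 tsub_le_self
      have hbU : divExp q b ∉ U := fun h => ha (hU hba h)
      rw [hg, if_neg hbU, mul_one]
      have h1 : ι (y (divExp q b) 1) = monomial (a - divExp q b) (1 : k) • ι (y a 1) := by
        rw [hy _ _ hbU, hy _ _ ha]
        ext d
        rw [monomial_smul_apply, one_mul, Finsupp.single_apply, Finsupp.single_apply]
        congr 1
        rw [eq_iff_iff]
        constructor
        · rintro rfl
          exact (tsub_add_cancel_of_le hba).symm
        · intro h
          refine add_left_cancel (a := a - divExp q b) ?_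
          rw [← h, tsub_add_cancel_of_le hba]
      rw [hψ _ _ _ h1, monomial_pow, one_pow, monomial_smul_apply, one_mul]
      congr 1
      ext i
      have h2 := hc i
      have h3 := hba i
      have h4 : b i = q * a i + (q - 1) - c i := rfl
      have h5 := Nat.mul_le_mul_left q h3
      have h6 := Nat.div_add_mod (b i) q
      have h7 := Nat.mod_lt (b i) hq
      rw [frobExp_apply] at h2
      simp only [Finsupp.add_apply, Finsupp.smul_apply, Finsupp.tsub_apply, smul_eq_mul,
        frobExp_apply, Nat.mul_sub, divExp_apply] at h5 ⊢
      omega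
    · -- `x_i^{a_i+1}` kills `x^{-a}`, so `x_i^{q(a_i+1)}` kills its image
      rw [Finsupp.le_def] at hc
      push Not at hc
      obtain ⟨i, hi⟩ := hc
      rw [frobExp_apply] at hi
      have h1 : ι 0 = monomial (Finsupp.single i (a i + 1)) (1 : k) • ι (y a 1) := by
        rw [hy _ _ ha, map_zero]
        ext d
        rw [monomial_smul_apply, one_mul, Finsupp.single_apply, if_neg]
        · rfl
        · intro h
          have := DFunLike.congr_fun h i
          simp only [Finsupp.add_apply, Finsupp.single_eq_same] at this
          omega
      have h2 := hψ _ _ _ h1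
      rw [map_zero, monomial_pow, one_pow] at h2
      have h3 : q • Finsupp.single i (a i + 1) ≤ c := by
        rw [Finsupp.smul_single, Finsupp.single_le_iff, smul_eq_mul, mul_add]
        omega
      have h4 := DFunLike.congr_fun h2 (c - q • Finsupp.single i (a i + 1))
      rw [monomial_smul_apply, one_mul, add_tsub_cancel_of_le h3] at h4
      exact h4.symm
  have key' : ∀ a c, a ∉ U → ψ (y a c) = g • frob p e (ι (y a c)) := by
    intro a c ha
    have h1 : ι (y a c) = (C c : MvPowerSeries σ k) • ι (y a 1) := by
      rw [hy _ _ ha, hy _ _ ha, C_smul, Finsupp.smul_single, smul_eq_mul, mul_one]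
    rw [hψ _ _ _ h1, h1, frob_smul, hy _ _ ha, frob_single, one_pow, key a ha, smul_comm]
  refine ⟨g, fun m => ?_⟩
  have hm : m = ∑ a ∈ (ι m).support, y a (ι m a) := by
    apply hι
    rw [map_sum]
    conv_lhs => rw [← Finsupp.sum_single (ι m)]
    refine Finset.sum_congr rfl fun a ha => (hy _ _ fun haU => ?_).symm
    have h1 : ι m ∈ Set.range ι := ⟨m, rfl⟩
    rw [hrange] at h1
    exact Finsupp.mem_support_iff.1 ha (h1 a haU)
  have hsupp : ∀ a ∈ (ι m).support, a ∉ U := fun a ha haU => by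
    have h1 : ι m ∈ Set.range ι := ⟨m, rfl⟩
    rw [hrange] at h1
    exact Finsupp.mem_support_iff.1 ha (h1 a haU)
  obtain ⟨F, w, hF, hm⟩ : ∃ (F : Finset (σ →₀ ℕ)) (w : (σ →₀ ℕ) → k), (∀ a ∈ F, a ∉ U) ∧
      m = ∑ a ∈ F, y a (w a) := ⟨_, _, hsupp, hm⟩
  rw [hm, map_sum, map_sum, map_sum, Finset.smul_sum]
  exact Finset.sum_congr rfl fun a ha => key' a _ (hF a ha)

/-- `g θᵉ` vanishes on the annihilator of `I` if and only if `g ∈ I^{[q]}`. -/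
theorem forall_smul_frob_eq_zero_iff (hU : IsUpperSet U)
    (hrange : Set.range ι = {y | ∀ a ∈ U, y a = 0}) (e : ℕ) (g : MvPowerSeries σ k) :
    (∀ m, g • frob p e (ι m) = 0) ↔ ∀ b, coeff b g ≠ 0 → divExp (p ^ e) b ∈ U := by
  classical
  have hq := pow_prime_pos p e
  constructor
  · intro h b
    contrapose!
    intro hb
    have : (Finsupp.single (divExp (p ^ e) b) 1 : InversePolynomial σ k) ∈ Set.range ι := by
      rw [hrange]
      intro a ha
      rw [Finsupp.single_apply, if_neg]
      rintro rfl
      exact hb ha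
    obtain ⟨m, hm⟩ := this
    have h1 := DFunLike.congr_fun (h m) (frobExp (p ^ e) (divExp (p ^ e) b) - b)
    rw [hm, frob_single, smul_single_apply, if_pos tsub_le_self,
      tsub_tsub_cancel_of_le ((le_frobExp_iff hq).2 le_rfl), one_pow, mul_one] at h1
    exact h1
  · intro h m
    ext c
    rw [smul_frob_apply]
    refine Finset.sum_eq_zero fun a ha => ?_
    dsimp only
    split_ifs with hc
    · by_contra hne
      have h1 := h _ (left_ne_zero_of_mul hne)
      have h2 : a ∈ U := hU ((le_frobExp_iff hq).1 tsub_le_self) h1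
      have h3 : ι m ∈ Set.range ι := ⟨m, rfl⟩
      rw [hrange] at h3
      exact Finsupp.mem_support_iff.1 ha (h3 a h2)
    · rfl

/-- `g θᵉ` preserves the annihilator of `I` if and only if `g ∈ (I^{[q]} : I)`. -/
theorem forall_smul_frob_mem_range_iff {G : Set (Finset σ)}
    (hrange : Set.range ι = {y | ∀ a ∈ monomialExponents G 1, y a = 0}) (e : ℕ)
    (g : MvPowerSeries σ k) :
    (∀ m, g • frob p e (ι m) ∈ Set.range ι) ↔
      ∀ b, coeff b g ≠ 0 → b ∈ colonExponents G (p ^ e) := by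
  classical
  have hq := pow_prime_pos p e
  constructor
  · intro h b hb c hc
    by_contra hbc
    rw [← divExp_mem_monomialExponents_iff hq] at hbc
    set a := divExp (p ^ e) (b + c)
    have : (Finsupp.single a 1 : InversePolynomial σ k) ∈ Set.range ι := by
      rw [hrange]
      intro a' ha'
      rw [Finsupp.single_apply, if_neg]
      rintro rfl
      exact hbc ha'
    obtain ⟨m, hm⟩ := this
    have h1 := h m
    rw [hrange] at h1
    have hle : b + c ≤ frobExp (p ^ e) a := (le_frobExp_iff hq).2 le_rfl
    have h2 := h1 (frobExp (p ^ e) a - b)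
      (monomialExponents_mono (le_tsub_of_add_le_left hle) hc)
    rw [hm, frob_single, smul_single_apply, if_pos tsub_le_self,
      tsub_tsub_cancel_of_le (le_self_add.trans hle), one_pow, mul_one] at h2
    exact hb h2
  · intro h m
    rw [hrange]
    intro c hc
    rw [smul_frob_apply]
    refine Finset.sum_eq_zero fun a ha => ?_
    dsimp only
    split_ifs with hca
    · by_contra hne
      have h1 := h _ (left_ne_zero_of_mul hne) c hc
      rw [tsub_add_cancel_of_le hca, ← divExp_mem_monomialExponents_iff hq,
        divExp_frobExp hq] at h1
      have h3 : ι m ∈ Set.range ι := ⟨m, rfl⟩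
      rw [hrange] at h3
      exact Finsupp.mem_support_iff.1 ha (h3 a h1)
    · rfl

end Embedded

end InversePolynomial
end

noncomputable section

open scoped DirectSum
open MvPowerSeries InversePolynomial

/-! ### Multiplication in the ring of Frobenius operators -/

section FrobeniusAlgebra

variable {p : ℕ} {R : Type u} [CommRing R] {M : Type v} [AddCommGroup M] [Module R M]

theorem of_frobeniusOps_congr {i j : ℕ} (h : i = j) {φ : frobeniusOps p R M i}
    {ψ : frobeniusOps p R M j} (hφ : (φ : AddMonoid.End M) = ψ) :
    DirectSum.of (fun e => frobeniusOps p R M e) i φ =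
      DirectSum.of (fun e => frobeniusOps p R M e) j ψ := by
  subst h
  rw [Subtype.ext hφ]

theorem of_mul_of_frobeniusOps {i j : ℕ} (φ : frobeniusOps p R M i) (ψ : frobeniusOps p R M j) :
    DirectSum.of (fun e => frobeniusOps p R M e) i φ *
        DirectSum.of (fun e => frobeniusOps p R M e) j ψ =
      DirectSum.of (fun e => frobeniusOps p R M e) (i + j)
        ⟨φ.1 * ψ.1, SetLike.mul_mem_graded φ.2 ψ.2⟩ := by
  rw [DirectSum.of_mul_of]
  exact of_frobeniusOps_congr rfl (SetLike.coe_gMul (frobeniusOps p R M) φ ψ)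

theorem pow_mem_frobeniusOps (T : frobeniusOps p R M 1) (n : ℕ) :
    (T : AddMonoid.End M) ^ n ∈ frobeniusOps p R M n := by
  have := SetLike.pow_mem_graded n T.2
  rwa [smul_eq_mul, mul_one] at this

theorem of_pow_frobeniusOps (T : frobeniusOps p R M 1) (n : ℕ) :
    DirectSum.of (fun e => frobeniusOps p R M e) 1 T ^ n =
      DirectSum.of (fun e => frobeniusOps p R M e) n ⟨T.1 ^ n, pow_mem_frobeniusOps T n⟩ := by
  induction n with
  | zero => rfl
  | succ n ih =>
    rw [pow_succ, ih, of_mul_of_frobeniusOps]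
    exact of_frobeniusOps_congr rfl (pow_succ _ _).symm

/-- The structure map `R → 𝓕(M)`. -/
def frobeniusStructureMap (p : ℕ) (R : Type u) [CommRing R] (M : Type v) [AddCommGroup M]
    [Module R M] : R →+* FrobeniusAlgebra p R M where
  toFun r := DirectSum.of (fun e => frobeniusOps p R M e) 0 (frobeniusScalar p R M r)
  map_one' := by
    have : frobeniusScalar p R M 1 = (1 : frobeniusOps p R M 0) :=
      Subtype.ext (map_one (Module.toAddMonoidEnd R M))
    rw [this]
    rfl
  map_mul' r s := by
    rw [of_mul_of_frobeniusOps]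
    exact of_frobeniusOps_congr rfl (map_mul (Module.toAddMonoidEnd R M) r s)
  map_zero' := by
    have : frobeniusScalar p R M 0 = 0 := Subtype.ext (map_zero (Module.toAddMonoidEnd R M))
    rw [this, map_zero]
  map_add' r s := by
    rw [← map_add]
    exact of_frobeniusOps_congr rfl (map_add (Module.toAddMonoidEnd R M) r s)

theorem frobeniusStructureMap_mul_of_pow (T : frobeniusOps p R M 1) (n : ℕ)
    (r : R) (φ : frobeniusOps p R M n) (h : ∀ m, φ.1 m = r • (T.1 ^ n) m) :
    frobeniusStructureMap p R M r * DirectSum.of (fun e => frobeniusOps p R M e) 1 T ^ n =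
      DirectSum.of (fun e => frobeniusOps p R M e) n φ := by
  rw [of_pow_frobeniusOps]
  refine (of_mul_of_frobeniusOps _ _).trans (of_frobeniusOps_congr (zero_add n) ?_)
  exact DFunLike.ext _ _ fun m => (h m).symm

/-- If every `pᵉ`-linear operator is `r Tᵉ` for some `r`, the ring of Frobenius operators is
principally generated. -/
theorem frobeniusPrincipallyGenerated_of_forall (T : frobeniusOps p R M 1)
    (h : ∀ (n : ℕ) (φ : frobeniusOps p R M n), ∃ r : R, ∀ m, φ.1 m = r • (T.1 ^ n) m) :
    FrobeniusPrincipallyGenerated p R M := by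
  refine ⟨T, (Subring.eq_top_iff' _).2 fun x => ?_⟩
  induction x using DirectSum.induction_on with
  | zero => exact Subring.zero_mem _
  | add x y hx hy => exact Subring.add_mem _ hx hy
  | of n φ =>
    obtain ⟨r, hr⟩ := h n φ
    rw [← frobeniusStructureMap_mul_of_pow T n r φ hr]
    exact Subring.mul_mem _ (Subring.subset_closure (.inl ⟨_, rfl⟩))
      (Subring.pow_mem _ (Subring.subset_closure (.inr rfl)) n)

/-- The skew polynomial ring maps to the ring of Frobenius operators by evaluation at an operator
of degree one. -/
def skewPolynomialEval [ExpChar R p] (T : frobeniusOps p R M 1) :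
    FrobeniusSkewPolynomial p R →+* FrobeniusAlgebra p R M :=
  letI := frobeniusAction p R
  SkewMonoidAlgebra.liftNCRingHom (frobeniusStructureMap p R M)
    (powersHom _ (DirectSum.of (fun e => frobeniusOps p R M e) 1 T)) (by
      intro r y
      change frobeniusStructureMap p R M (iterateFrobenius R p y.toAdd r) *
        DirectSum.of (fun e => frobeniusOps p R M e) 1 T ^ y.toAdd =
          DirectSum.of (fun e => frobeniusOps p R M e) 1 T ^ y.toAdd * frobeniusStructureMap p R M r
      rw [of_pow_frobeniusOps]
      refine (of_mul_of_frobeniusOps _ _).trans (Eq.trans ?_ (of_mul_of_frobeniusOps _ _).symm)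
      refine of_frobeniusOps_congr (by rw [zero_add, add_zero]) (DFunLike.ext _ _ fun m => ?_)
      change iterateFrobenius R p y.toAdd r • (T.1 ^ y.toAdd) m = (T.1 ^ y.toAdd) (r • m)
      rw [pow_mem_frobeniusOps T y.toAdd r m, iterateFrobenius_def])

theorem skewPolynomialEval_single [ExpChar R p] (T : frobeniusOps p R M 1) (n : ℕ) (r : R) :
    skewPolynomialEval T (SkewMonoidAlgebra.single (Multiplicative.ofAdd n) r : SkewPolynomial R) =
      frobeniusStructureMap p R M r * DirectSum.of (fun e => frobeniusOps p R M e) 1 T ^ n := by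
  let := frobeniusAction p R
  exact SkewMonoidAlgebra.liftNC_single _ _ _ _

theorem skewPolynomialEval_C [ExpChar R p] (T : frobeniusOps p R M 1) (r : R) :
    skewPolynomialEval T (FrobeniusSkewPolynomial.C p R r) = frobeniusStructureMap p R M r := by
  refine (skewPolynomialEval_single T 0 r).trans ?_
  rw [pow_zero, mul_one]

theorem skewPolynomialEval_X [ExpChar R p] (T : frobeniusOps p R M 1) :
    skewPolynomialEval T (FrobeniusSkewPolynomial.X p R) =
      DirectSum.of (fun e => frobeniusOps p R M e) 1 T := by
  refine (skewPolynomialEval_single T 1 1).trans ?_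
  rw [pow_one, map_one, one_mul]

theorem skewPolynomialEval_apply [ExpChar R p] (T : frobeniusOps p R M 1) (x : SkewPolynomial R)
    (n : ℕ) (m : M) :
    ((skewPolynomialEval T x : FrobeniusAlgebra p R M) n).1 m =
      SkewMonoidAlgebra.coeff x (Multiplicative.ofAdd n) • (T.1 ^ n) m := by
  induction x using SkewMonoidAlgebra.induction_on' with
  | single a r =>
    obtain ⟨j, rfl⟩ := Multiplicative.ofAdd.surjective a
    have hmem : Module.toAddMonoidEnd R M r * T.1 ^ j ∈ frobeniusOps p R M j := by
      have := SetLike.mul_mem_graded (frobeniusScalar p R M r).2 (pow_mem_frobeniusOps T j)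
      rwa [zero_add] at this
    rw [skewPolynomialEval_single,
      frobeniusStructureMap_mul_of_pow T j r ⟨_, hmem⟩ fun _ => rfl,
      SkewMonoidAlgebra.coeff_single, Finsupp.single_apply]
    by_cases hj : j = n
    · subst hj
      rw [DirectSum.of_eq_same, if_pos rfl]
      rfl
    · rw [DirectSum.of_eq_of_ne _ _ _ (Ne.symm hj),
        if_neg fun h => hj (Multiplicative.ofAdd.injective h), zero_smul]
      rfl
  | add x y hx hy =>
    rw [SkewMonoidAlgebra.coeff_add, Finsupp.add_apply, add_smul, ← hx, ← hy]
    have := map_add (skewPolynomialEval (M := M) T) x y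
    refine (congrArg (fun z : FrobeniusAlgebra p R M => (z n).1 m) this).trans ?_
    rfl

/-- If every `pᵉ`-linear operator is `r Tᵉ` for a unique `r`, evaluation at `T` is bijective. -/
theorem skewPolynomialEval_bijective [ExpChar R p] (T : frobeniusOps p R M 1)
    (h : ∀ (n : ℕ) (φ : frobeniusOps p R M n), ∃ r : R, ∀ m, φ.1 m = r • (T.1 ^ n) m)
    (h' : ∀ (n : ℕ) (r : R), (∀ m, r • (T.1 ^ n) m = 0) → r = 0) :
    Function.Bijective (skewPolynomialEval (p := p) (M := M) T) := by
  constructor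
  · refine (injective_iff_map_eq_zero _).2 fun x hx => ?_
    refine SkewMonoidAlgebra.ext (p := (x : SkewPolynomial R)) (q := 0) fun n => ?_
    refine h' n.toAdd _ fun m => ?_
    refine (skewPolynomialEval_apply T x n.toAdd m).symm.trans ?_
    rw [hx]
    rfl
  · intro y
    induction y using DirectSum.induction_on with
    | zero => exact ⟨0, map_zero _⟩
    | add x y hx hy =>
      obtain ⟨x, rfl⟩ := hx
      obtain ⟨y, rfl⟩ := hy
      exact ⟨x + y, map_add _ _ _⟩
    | of n φ =>
      obtain ⟨r, hr⟩ := h n φ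
      exact ⟨(SkewMonoidAlgebra.single (Multiplicative.ofAdd n) r : SkewPolynomial R),
        (skewPolynomialEval_single T n r).trans (frobeniusStructureMap_mul_of_pow T n r φ hr)⟩

end FrobeniusAlgebra
end

noncomputable section

open scoped DirectSum
open MvPowerSeries InversePolynomial

/-! ### Frobenius operators as power series -/

section Represent

variable {σ : Type} {k : Type u} [Field k]

/-- An identification of the `S ⧸ I`-module `E` with the annihilator of `I` in the inverse
polynomials, for `I` the monomial ideal with generators `G`. -/
structure IsInverseSystem (G : Set (Finset σ)) (I : Ideal (MvPowerSeries σ k)) {E : Type u}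
    [AddCommGroup E] [Module (MvPowerSeries σ k ⧸ I) E] (ι : E →+ InversePolynomial σ k) :
    Prop where
  eq_ideal : I = exponentIdeal k _ (isUpperSet_monomialExponents G 1)
  injective : Function.Injective ι
  smul : ∀ (s : MvPowerSeries σ k) (m : E), ι (Ideal.Quotient.mk I s • m) = s • ι m
  range_eq : Set.range ι = {y | ∀ a ∈ monomialExponents G 1, y a = 0}

theorem coeff_mul_eq_zero_of_le {g h : MvPowerSeries σ k} {a : σ →₀ ℕ}
    (hg : ∀ c ≤ a, coeff c g = 0) {c : σ →₀ ℕ}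
    (hc : c ≤ a) : coeff c (g * h) = 0 := by
  by_contra hne
  obtain ⟨b, d, rfl, hb, -⟩ := exists_add_of_coeff_mul_ne_zero hne
  exact hb (hg b (le_self_add.trans hc))

variable [Finite σ] (p : ℕ) [Fact p.Prime] [CharP k p]
  {E : Type u} [AddCommGroup E] {ι : E →+ InversePolynomial σ k}

/-- The operator `φ` is the restriction of `g θᵉ`. -/
def Represents (ι : E →+ InversePolynomial σ k) (e : ℕ) (φ : AddMonoid.End E)
    (g : MvPowerSeries σ k) : Prop :=
  ∀ m, ι (φ m) = g • frob p e (ι m)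

variable {p} {e e' : ℕ} {φ ψ : AddMonoid.End E} {g h : MvPowerSeries σ k}

theorem Represents.add (hφ : Represents p ι e φ g) (hψ : Represents p ι e ψ h) :
    Represents p ι e (φ + ψ) (g + h) := fun m => by
  rw [add_smul, ← hφ m, ← hψ m, ← map_add]
  rfl

theorem Represents.neg (hφ : Represents p ι e φ g) : Represents p ι e (-φ) (-g) := fun m => by
  rw [neg_smul, ← hφ m, ← map_neg]
  rfl

theorem Represents.zero : Represents p ι e 0 (0 : MvPowerSeries σ k) := fun m => by
  rw [zero_smul]
  exact map_zero ι

/-- `(g θᵉ)(h θᵉ') = g h^{pᵉ} θᵉ⁺ᵉ'`. -/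
theorem Represents.mul (hφ : Represents p ι e φ g) (hψ : Represents p ι e' ψ h) :
    Represents p ι (e + e') (φ * ψ) (g * h ^ p ^ e) := fun m => by
  change ι (φ (ψ m)) = _
  rw [hφ, hψ, frob_smul, mul_smul]
  congr 2
  rw [← frob_one_pow p (e + e'), pow_add, frob_one_pow, frob_one_pow]
  rfl

namespace IsInverseSystem

variable {I : Ideal (MvPowerSeries σ k)} [Module (MvPowerSeries σ k ⧸ I) E]
variable {G : Set (Finset σ)} (hS : IsInverseSystem G I ι)

include hS

theorem exists_represents (hφ : φ ∈ frobeniusOps p (MvPowerSeries σ k ⧸ I) E e) :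
    ∃ g, Represents p ι e φ g := by
  refine exists_forall_eq_smul_frob p hS.injective (isUpperSet_monomialExponents G 1) hS.range_eq e
    (ι.comp φ) fun s m m' hm => ?_
  rw [← hS.smul] at hm
  change ι (φ m') = s ^ p ^ e • ι (φ m)
  rw [hS.injective hm, hφ, ← map_pow, hS.smul]

theorem mem_colonExponents (hφ : Represents p ι e φ g) {b : σ →₀ ℕ} (hb : coeff b g ≠ 0) :
    b ∈ colonExponents G (p ^ e) :=
  (forall_smul_frob_mem_range_iff p hS.range_eq e g).1 (fun m => ⟨φ m, hφ m⟩) b hb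

theorem represents_zero_iff : Represents p ι e (0 : AddMonoid.End E) g ↔
    ∀ b, coeff b g ≠ 0 → b ∈ monomialExponents G (p ^ e) := by
  have h := forall_smul_frob_eq_zero_iff p (isUpperSet_monomialExponents G 1) hS.range_eq e g
  simp only [divExp_mem_monomialExponents_iff (pow_prime_pos p e)] at h
  rw [← h]
  refine forall_congr' fun m => ?_
  change ι 0 = _ ↔ _
  rw [map_zero, eq_comm]

theorem mem_frobeniusOps (hφ : Represents p ι e φ g) :
    φ ∈ frobeniusOps p (MvPowerSeries σ k ⧸ I) E e := by
  intro r m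
  obtain ⟨s, rfl⟩ := Ideal.Quotient.mk_surjective r
  apply hS.injective
  rw [hφ, hS.smul, frob_smul, ← map_pow, hS.smul, hφ, smul_comm]

theorem exists_operator (hg : ∀ b, coeff b g ≠ 0 → b ∈ colonExponents G (p ^ e)) :
    ∃ φ : frobeniusOps p (MvPowerSeries σ k ⧸ I) E e, Represents p ι e φ.1 g := by
  choose f hf using (forall_smul_frob_mem_range_iff p hS.range_eq e g).2 hg
  let φ : AddMonoid.End E :=
    { toFun := f
      map_zero' := hS.injective (by rw [hf, map_zero, map_zero, smul_zero])
      map_add' := fun x y => hS.injective (by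
        rw [map_add, hf, hf, hf, map_add, map_add, smul_add]) }
  have hφ : Represents p ι e φ g := hf
  exact ⟨⟨φ, hS.mem_frobeniusOps hφ⟩, hφ⟩

theorem mem_monomialExponents_of_sub (hφ : Represents p ι e φ g) (hφ' : Represents p ι e φ h)
    {b : σ →₀ ℕ} (hb : coeff b g ≠ coeff b h) : b ∈ monomialExponents G (p ^ e) := by
  have h0 : Represents p ι e (0 : AddMonoid.End E) (g + -h) := by
    have := hφ.add hφ'.neg
    rwa [add_neg_cancel] at this
  refine hS.represents_zero_iff.1 h0 b ?_
  rwa [map_add, map_neg, ← sub_eq_add_neg, sub_ne_zero]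

end IsInverseSystem
end Represent

/-! ### The infinitely generated case -/

section InfiniteGeneration

variable {σ : Type} {k : Type u} [Field k] [Fintype σ] {p : ℕ} [Fact p.Prime] [CharP k p]
  {I : Ideal (MvPowerSeries σ k)} {E : Type u} [AddCommGroup E]
  [Module (MvPowerSeries σ k ⧸ I) E] {ι : E →+ InversePolynomial σ k} {G : Set (Finset σ)}

/-- The operators `g θᵉ` with no monomial of `g` dividing the monomial attached to `T`. They form a
bimodule over `𝓕⁰(E)` which, for a minimal obstruction `T`, contains all products of two operators of
positive degree, but not the operator given by the monomial attached to `T`. -/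
def decomposableOps (p : ℕ) [Fact p.Prime] [CharP k p] (ι : E →+ InversePolynomial σ k)
    (G : Set (Finset σ)) (T : Finset σ) (e : ℕ) : AddSubgroup (AddMonoid.End E) where
  carrier := {φ | ∃ g : MvPowerSeries σ k, Represents p ι e φ g ∧
    ∀ c ≤ obstructionExponent G T (p ^ e), coeff c g = 0}
  zero_mem' := ⟨0, Represents.zero, by simp⟩
  add_mem' := by
    rintro φ ψ ⟨g, hg, hg'⟩ ⟨h, hh, hh'⟩
    exact ⟨g + h, hg.add hh, fun c hc => by rw [map_add, hg' c hc, hh' c hc, add_zero]⟩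
  neg_mem' := by
    rintro φ ⟨g, hg, hg'⟩
    exact ⟨-g, hg.neg, fun c hc => by rw [map_neg, hg' c hc, neg_zero]⟩

variable {T : Finset σ}

theorem IsInverseSystem.mul_mem_decomposableOps_of_pos (hS : IsInverseSystem G I ι)
    (hT : Minimal (IsObstruction G) T) {i j : ℕ} (hi : 1 ≤ i) (hj : 1 ≤ j)
    {φ ψ : AddMonoid.End E} (hφ : φ ∈ frobeniusOps p (MvPowerSeries σ k ⧸ I) E i)
    (hψ : ψ ∈ frobeniusOps p (MvPowerSeries σ k ⧸ I) E j) :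
    φ * ψ ∈ decomposableOps (k := k) p ι G T (i + j) := by
  obtain ⟨g, hg⟩ := hS.exists_represents hφ
  obtain ⟨h, hh⟩ := hS.exists_represents hψ
  refine ⟨_, hg.mul hh, fun c hc => ?_⟩
  by_contra hne
  obtain ⟨b, d, rfl, hb, hd⟩ := exists_add_of_coeff_mul_ne_zero hne
  obtain ⟨d, rfl, hd'⟩ := exists_nsmul_of_coeff_pow_ne_zero p hd
  have two_le : ∀ e, 1 ≤ e → 2 ≤ p ^ e := fun e he =>
    (Fact.out : p.Prime).two_le.trans (Nat.le_self_pow (by omega) p)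
  rw [pow_add] at hc
  exact not_add_le_obstructionExponent hT (two_le i hi) (two_le j hj)
    (hS.mem_colonExponents hg hb) (hS.mem_colonExponents hh hd') hc

theorem IsInverseSystem.scalar_mul_mem_decomposableOps (hS : IsInverseSystem G I ι) {i : ℕ}
    {φ ψ : AddMonoid.End E} (hφ : φ ∈ frobeniusOps p (MvPowerSeries σ k ⧸ I) E 0)
    (hψ : ψ ∈ decomposableOps (k := k) p ι G T i) :
    φ * ψ ∈ decomposableOps (k := k) p ι G T i := by
  obtain ⟨g, hg⟩ := hS.exists_represents hφ
  obtain ⟨h, hh, hh'⟩ := hψ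
  have := hg.mul hh
  rw [zero_add, pow_zero, pow_one, mul_comm] at this
  exact ⟨_, this, fun c hc => coeff_mul_eq_zero_of_le hh' hc⟩

theorem IsInverseSystem.mul_scalar_mem_decomposableOps (hS : IsInverseSystem G I ι) {i : ℕ}
    {φ ψ : AddMonoid.End E} (hφ : φ ∈ decomposableOps (k := k) p ι G T i)
    (hψ : ψ ∈ frobeniusOps p (MvPowerSeries σ k ⧸ I) E 0) :
    φ * ψ ∈ decomposableOps (k := k) p ι G T i := by
  obtain ⟨h, hh⟩ := hS.exists_represents hψ
  obtain ⟨g, hg, hg'⟩ := hφ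
  have := hg.mul hh
  rw [add_zero] at this
  exact ⟨_, this, fun c hc => coeff_mul_eq_zero_of_le hg' hc⟩

/-- The operators whose components of degree `> N` are decomposable form a subring. -/
def IsInverseSystem.boundedSubring (hS : IsInverseSystem G I ι)
    (hT : Minimal (IsObstruction G) T) (N : ℕ) :
    Subring (FrobeniusAlgebra p (MvPowerSeries σ k ⧸ I) E) where
  carrier := {x | ∀ e, N < e → (x e).1 ∈ decomposableOps (k := k) p ι G T e}
  zero_mem' := fun e _ => (decomposableOps (k := k) p ι G T e).zero_mem
  add_mem' := fun hx hy e he => (decomposableOps (k := k) p ι G T e).add_mem (hx e he) (hy e he)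
  neg_mem' := fun hx e he => (decomposableOps (k := k) p ι G T e).neg_mem (hx e he)
  one_mem' := fun e he => by
    have : (1 : FrobeniusAlgebra p (MvPowerSeries σ k ⧸ I) E) e = 0 :=
      DirectSum.of_eq_of_ne (β := fun e => frobeniusOps p (MvPowerSeries σ k ⧸ I) E e) 0 e 1
        (by omega)
    rw [this]
    exact (decomposableOps (k := k) p ι G T e).zero_mem
  mul_mem' := by
    intro x y hx hy e he
    have hxy : ((x * y) e).1 =
        ∑ ij ∈ Finset.HasAntidiagonal.antidiagonal e, (x ij.1).1 * (y ij.2).1 :=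
      DirectSum.coe_mul_apply_eq_sum_antidiagonal (frobeniusOps p (MvPowerSeries σ k ⧸ I) E) x y e
    rw [hxy]
    refine AddSubgroup.sum_mem _ ?_
    rintro ⟨i, j⟩ hij
    rw [Finset.HasAntidiagonal.mem_antidiagonal] at hij
    dsimp only at hij ⊢
    subst hij
    rcases Nat.eq_zero_or_pos i with rfl | hi
    · rw [zero_add] at he ⊢
      exact hS.scalar_mul_mem_decomposableOps (x 0).2 (hy j he)
    · rcases Nat.eq_zero_or_pos j with rfl | hj
      · exact hS.mul_scalar_mem_decomposableOps (hx i he) (y 0).2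
      · exact hS.mul_mem_decomposableOps_of_pos hT hi hj (x i).2 (y j).2

/-- An obstruction forces a new generator of the ring of Frobenius operators in every degree. -/
theorem IsInverseSystem.not_frobeniusFinitelyGenerated (hS : IsInverseSystem G I ι)
    (hG : ∃ T, IsObstruction G T) :
    ¬ FrobeniusFinitelyGenerated p (MvPowerSeries σ k ⧸ I) E := by
  classical
  obtain ⟨T, hT⟩ := hG
  obtain ⟨T, hT⟩ := exists_minimal_obstruction hT
  rintro ⟨A, hA⟩
  -- `N` bounds the degrees of the generators
  let N := A.sup fun x => x.support.sup id
  have hsub : hS.boundedSubring hT N = ⊤ := by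
    rw [eq_top_iff, ← hA, Subring.closure_le]
    rintro x (⟨φ, rfl⟩ | hx) e he
    · rw [DirectSum.of_eq_of_ne _ _ _ (by omega)]
      exact (decomposableOps (k := k) p ι G T e).zero_mem
    · have hxe : x e = 0 := by
        by_contra hne
        have h1 : e ≤ x.support.sup id :=
          Finset.le_sup (f := id) (DFinsupp.mem_support_iff.2 hne)
        have h2 : x.support.sup id ≤ N := Finset.le_sup (f := fun x => x.support.sup id) hx
        omega
      rw [hxe]
      exact (decomposableOps (k := k) p ι G T e).zero_mem
  set a := obstructionExponent G T (p ^ (N + 1)) with ha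
  obtain ⟨φ, hφ⟩ := hS.exists_operator (p := p) (e := N + 1) (g := monomial a 1) fun b hb => by
    rw [coeff_monomial] at hb
    have hba : b = a := by
      by_contra hc
      simp [hc] at hb
    rw [hba]
    exact obstructionExponent_mem_colon G T _
  have hmem : DirectSum.of (fun e => frobeniusOps p (MvPowerSeries σ k ⧸ I) E e) (N + 1) φ ∈
      hS.boundedSubring hT N := hsub ▸ Subring.mem_top _
  have h1 := hmem (N + 1) (Nat.lt_succ_self N)
  rw [DirectSum.of_eq_same] at h1
  obtain ⟨g, hg, hg0⟩ := h1
  -- `φ = x^a θ^{N+1} = g θ^{N+1}`, although the coefficients of `x^a` and `g` at `a` differ and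
  -- `x^a ∉ I^{[q]}`
  refine obstructionExponent_notMem hT.1 (pow_prime_pos p (N + 1))
    (hS.mem_monomialExponents_of_sub hφ hg (b := a) ?_)
  rw [hg0 a le_rfl, coeff_monomial_same]
  exact one_ne_zero

end InfiniteGeneration
end

noncomputable section

open scoped DirectSum
open MvPowerSeries InversePolynomial

/-! ### The principally generated case -/

section Principal

variable {σ : Type} {k : Type u} [Field k]

/-- Modulo the series supported on an upper set `N`, a series supported on `N` and the multiples of
`x^w` is a multiple of `x^w`. -/
theorem exists_coeff_mul_monomial_eq {N : Set (σ →₀ ℕ)} (w : σ →₀ ℕ) (g : MvPowerSeries σ k)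
    (hg : ∀ b, coeff b g ≠ 0 → b ∉ N → w ≤ b) :
    ∃ h : MvPowerSeries σ k, ∀ b, coeff b (h * monomial w 1) ≠ coeff b g → b ∈ N := by
  classical
  let h : MvPowerSeries σ k := fun b => coeff (b + w) g
  refine ⟨h, fun b hb => ?_⟩
  by_contra hN
  refine hb ?_
  rw [coeff_mul_monomial, mul_one]
  split_ifs with hw
  · change coeff (b - w + w) g = _
    rw [tsub_add_cancel_of_le hw]
  · by_contra hne
    exact hw (hg b (Ne.symm hne) hN)

variable [Fintype σ] {p : ℕ} [Fact p.Prime] [CharP k p] {I : Ideal (MvPowerSeries σ k)}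
  {E : Type u} [AddCommGroup E] [Module (MvPowerSeries σ k ⧸ I) E]
  {ι : E →+ InversePolynomial σ k} {G : Set (Finset σ)}

theorem Represents.pow {T : AddMonoid.End E} {u : MvPowerSeries σ k}
    (hT : Represents p ι 1 T (u ^ (p - 1))) (n : ℕ) :
    Represents p ι n (T ^ n) (u ^ (p ^ n - 1)) := by
  induction n with
  | zero =>
    intro m
    rw [pow_zero, pow_zero, Nat.sub_self, pow_zero, one_smul, ← frob_one_pow p 0, pow_zero]
    rfl
  | succ n ih =>
    have h := ih.mul hT
    rw [← pow_succ, ← pow_mul, ← pow_add] at h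
    have h1 := pow_prime_pos p n
    have h2 := (Fact.out : p.Prime).pos
    have h3 : p ^ n - 1 + (p - 1) * p ^ n = p ^ (n + 1) - 1 := by
      rw [Nat.sub_mul, one_mul, pow_succ']
      have := Nat.le_mul_of_pos_left (p ^ n) h2
      omega
    rwa [h3] at h

/-- Without an obstruction, each `𝓕ᵉ(E)` is free of rank one over `R = S ⧸ I`, generated by the
`e`-th power of the restriction of `u^{p-1} θ`. -/
theorem IsInverseSystem.exists_generator (hS : IsInverseSystem G I ι)
    (hG : ∀ T, ¬ IsObstruction G T) {A : Finset σ} (hA : ∀ i, i ∈ A ↔ i ∈ coverVars G) :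
    ∃ T : frobeniusOps p (MvPowerSeries σ k ⧸ I) E 1,
      Represents p ι 1 T.1 ((∏ i ∈ A, (X i : MvPowerSeries σ k)) ^ (p - 1)) ∧
      (∀ (n : ℕ) (φ : frobeniusOps p (MvPowerSeries σ k ⧸ I) E n),
        ∃ r : MvPowerSeries σ k ⧸ I, ∀ m, φ.1 m = r • (T.1 ^ n) m) ∧
      ∀ (n : ℕ) (r : MvPowerSeries σ k ⧸ I), (∀ m, r • (T.1 ^ n) m = 0) → r = 0 := by
  classical
  obtain ⟨T, hT⟩ := hS.exists_operator (p := p) (e := 1)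
      (g := (∏ i ∈ A, (X i : MvPowerSeries σ k)) ^ (p - 1)) fun b hb => by
    rw [prod_X_pow_eq_monomial, coeff_monomial] at hb
    have hb' : b = ∑ i ∈ A, Finsupp.single i (p - 1) := by
      by_contra hc
      rw [if_neg hc] at hb
      exact hb rfl
    refine mem_colonExponents_of_le fun i hi => ?_
    rw [hb', sum_single_apply, if_pos ((hA i).2 hi), pow_one]
    omega
  have hTs : ∀ (n : ℕ) (s : MvPowerSeries σ k) (m : E),
      ι (Ideal.Quotient.mk I s • (T.1 ^ n) m) =
        (s * monomial (∑ i ∈ A, Finsupp.single i (p ^ n - 1)) 1) • frob p n (ι m) := by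
    intro n s m
    rw [hS.smul, hT.pow n m, mul_smul, prod_X_pow_eq_monomial]
  refine ⟨T, hT, fun n φ => ?_, fun n r hr => ?_⟩
  · obtain ⟨g, hg⟩ := hS.exists_represents φ.2
    obtain ⟨h, hh⟩ := exists_coeff_mul_monomial_eq (N := monomialExponents G (p ^ n))
      (∑ i ∈ A, Finsupp.single i (p ^ n - 1)) g fun b hb hbN => by
        refine sum_single_le_iff.2 fun i hi => ?_
        have := le_add_one_of_not_isObstruction hG (hS.mem_colonExponents hg hb) hbN ((hA i).1 hi)
        omega
    refine ⟨Ideal.Quotient.mk I h, fun m => hS.injective ?_⟩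
    rw [hg, hTs]
    have h0 := (hS.represents_zero_iff (p := p) (e := n)
      (g := h * monomial (∑ i ∈ A, Finsupp.single i (p ^ n - 1)) 1 - g)).2 fun b hb => by
        refine hh b fun heq => hb ?_
        rw [map_sub, heq, sub_self]
    have h1 := h0 m
    rw [sub_smul, eq_comm] at h1
    have h2 : ι ((0 : AddMonoid.End E) m) = 0 := map_zero ι
    rw [h2, sub_eq_zero] at h1
    exact h1.symm
  · obtain ⟨s, rfl⟩ := Ideal.Quotient.mk_surjective r
    rw [Ideal.Quotient.eq_zero_iff_mem, hS.eq_ideal]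
    intro b hb
    have h0 : Represents p ι n (0 : AddMonoid.End E)
        (s * monomial (∑ i ∈ A, Finsupp.single i (p ^ n - 1)) 1) := fun m => by
      rw [← hTs, hr m]
      rfl
    obtain ⟨g, hg, hle⟩ := hS.represents_zero_iff.1 h0
      (b + ∑ i ∈ A, Finsupp.single i (p ^ n - 1))
      (by rwa [coeff_add_mul_monomial, mul_one])
    refine ⟨g, hg, fun i hi => ?_⟩
    have h1 := hle i hi
    have := pow_prime_pos p n
    rw [Finsupp.add_apply, sum_single_apply] at h1
    split_ifs at h1 <;> omega

theorem IsInverseSystem.frobeniusPrincipallyGenerated (hS : IsInverseSystem G I ι)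
    (hG : ∀ T, ¬ IsObstruction G T) :
    FrobeniusPrincipallyGenerated p (MvPowerSeries σ k ⧸ I) E := by
  classical
  obtain ⟨T, -, h, -⟩ := hS.exists_generator (p := p) hG
    (A := Finset.univ.filter fun i => i ∈ coverVars G) (by simp)
  exact frobeniusPrincipallyGenerated_of_forall T h

/-- The action of Frobenius on the inverse polynomials, carried over to an isomorphic module, is
a natural Frobenius. -/
theorem isNaturalFrobenius_conj {E' : Type u} [AddCommGroup E'] [Module (MvPowerSeries σ k) E']
    (f : E' ≃ₗ[MvPowerSeries σ k] InversePolynomial σ k) {θ : AddMonoid.End E'}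
    (hθ : ∀ m, f (θ m) = frob p 1 (f m)) : IsNaturalFrobenius p (MvPowerSeries σ k) E' θ := by
  have hpow : ∀ e m, f ((θ ^ e) m) = frob p e (f m) := by
    intro e m
    rw [← frob_one_pow]
    induction e with
    | zero => rfl
    | succ e ih =>
      rw [pow_succ', pow_succ']
      change f (θ ((θ ^ e) m)) = frob p 1 ((frob p 1 ^ e) (f m))
      rw [hθ, ih]
  have hrange : Set.range (f.toLinearMap.toAddMonoidHom) =
      {y : InversePolynomial σ k | ∀ a ∈ (∅ : Set (σ →₀ ℕ)), y a = 0} := by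
    have : Set.range (f.toLinearMap.toAddMonoidHom) = Set.univ := f.surjective.range_eq
    rw [this]
    simp
  refine ⟨fun s m => f.injective ?_, fun e φ hφ => ?_⟩
  · rw [hθ, map_smul, frob_smul, map_smul, hθ]
  · obtain ⟨g, hg⟩ := exists_forall_eq_smul_frob p (ι := f.toLinearMap.toAddMonoidHom) f.injective
      isUpperSet_empty hrange e (f.toLinearMap.toAddMonoidHom.comp φ) fun s m m' hm => by
        have hm' : m' = s • m := f.injective (hm.trans (map_smul f s m).symm)
        change f (φ m') = s ^ p ^ e • f (φ m)
        rw [hm', hφ, map_smul]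
    have hg' : ∀ m, f (φ m) = g • frob p e (f m) := hg
    refine ⟨g, fun m => f.injective ?_, fun g' h' => ?_⟩
    · rw [hg', map_smul, hpow]
    · have h0 := (forall_smul_frob_eq_zero_iff p (ι := f.toLinearMap.toAddMonoidHom)
        isUpperSet_empty hrange e (g' - g)).1 fun m => by
          change (g' - g) • frob p e (f m) = 0
          rw [sub_smul, ← hg', h' m, map_smul, hpow, sub_self]
      rw [← sub_eq_zero]
      ext b
      by_contra hb
      exact h0 b hb

theorem IsInverseSystem.frobeniusAlgebraIsSkewPolynomialOn [ExpChar (MvPowerSeries σ k ⧸ I) p]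
    (hS : IsInverseSystem G I ι) (hG : ∀ T, ¬ IsObstruction G T)
    (hA : ∀ i, i ∈ coverVars G) {E' : Type u} [AddCommGroup E'] [Module (MvPowerSeries σ k) E']
    (hE' : IsInjectiveHullOfResidueField (MvPowerSeries σ k) E') :
    FrobeniusAlgebraIsSkewPolynomialOn p I E E'
      ((∏ i, (X i : MvPowerSeries σ k)) ^ (p - 1)) := by
  obtain ⟨T, hT, h, h'⟩ := hS.exists_generator (p := p) hG (A := Finset.univ)
    fun i => by simp [hA i]
  obtain ⟨f⟩ := hE'.nonempty_linearEquiv (isInjectiveHullOfResidueField (σ := σ) (k := k))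
  let θ : AddMonoid.End E' := f.symm.toLinearMap.toAddMonoidHom.comp
    ((frob p 1 : InversePolynomial σ k →+ InversePolynomial σ k).comp f.toLinearMap.toAddMonoidHom)
  have hθ : ∀ m, f (θ m) = frob p 1 (f m) := fun m => f.apply_symm_apply _
  refine ⟨f.symm.toLinearMap.toAddMonoidHom.comp ι, θ, T,
    RingEquiv.ofBijective (skewPolynomialEval T) (skewPolynomialEval_bijective T h h'),
    f.symm.injective.comp hS.injective, fun s m => ?_, ?_, isNaturalFrobenius_conj f hθ,
    fun m => ?_, fun r => skewPolynomialEval_C T r, skewPolynomialEval_X T⟩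
  · change f.symm (ι _) = s • f.symm (ι m)
    rw [hS.smul, map_smul]
  · have hann : ∀ y : InversePolynomial σ k, y ∈ Set.range ι ↔ ∀ a ∈ I, a • y = 0 := fun y => by
      rw [hS.range_eq, hS.eq_ideal, forall_smul_eq_zero_iff]
      rfl
    ext y
    have h1 : y ∈ Set.range (f.symm.toLinearMap.toAddMonoidHom.comp ι) ↔ f y ∈ Set.range ι :=
      exists_congr fun m => f.symm_apply_eq
    rw [h1, hann]
    refine forall₂_congr fun a _ => ?_
    rw [← map_smul, LinearEquiv.map_eq_zero_iff]
  · change f.symm (ι (T.1 m)) = _ • θ (f.symm (ι m))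
    apply f.injective
    rw [map_smul, hθ, f.apply_symm_apply, f.apply_symm_apply, hT]

end Principal
end

noncomputable section

open MvPowerSeries InversePolynomial

/-! ### Minimal primes of squarefree monomial ideals -/

section MinimalPrimes

variable {σ : Type} {k : Type u} [Field k]

theorem isUpperSet_exists_ne_zero (α : Finset σ) :
    IsUpperSet {a : σ →₀ ℕ | ∃ i ∈ α, a i ≠ 0} := fun _ _ hab ⟨i, hi, h⟩ =>
  ⟨i, hi, (lt_of_lt_of_le (Nat.pos_of_ne_zero h) (hab i)).ne'⟩

/-- The ideal generated by the variables in `α`, given by its monomials. -/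
def varsIdeal (k : Type u) [Field k] (α : Finset σ) : Ideal (MvPowerSeries σ k) :=
  exponentIdeal k _ (isUpperSet_exists_ne_zero α)

open Classical in
/-- The power series obtained from `f` by setting the variables in `α` to zero. -/
def killVarsFun (α : Finset σ) (f : MvPowerSeries σ k) : MvPowerSeries σ k :=
  fun a => if ∃ i ∈ α, a i ≠ 0 then 0 else coeff a f

open Classical in
theorem coeff_killVarsFun (α : Finset σ) (f : MvPowerSeries σ k) (a : σ →₀ ℕ) :
    coeff a (killVarsFun α f) = if ∃ i ∈ α, a i ≠ 0 then 0 else coeff a f := rfl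

/-- The endomorphism of the power series ring that sets the variables in `α` to zero. -/
def killVars (k : Type u) [Field k] (α : Finset σ) : MvPowerSeries σ k →+* MvPowerSeries σ k where
  toFun := killVarsFun α
  map_one' := by
    classical
    ext a
    rw [coeff_killVarsFun]
    split_ifs with h
    · rw [coeff_one, if_neg]
      rintro rfl
      simp at h
    · rfl
  map_zero' := by
    ext a
    rw [coeff_killVarsFun]
    split_ifs <;> simp
  map_add' f g := by
    ext a
    simp only [map_add, coeff_killVarsFun]
    split_ifs <;> simp
  map_mul' f g := by
    classical
    ext a
    rw [coeff_mul, coeff_killVarsFun]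
    split_ifs with h
    · refine (Finset.sum_eq_zero fun x hx => ?_).symm
      obtain ⟨i, hi, hai⟩ := h
      rw [← Finset.HasAntidiagonal.mem_antidiagonal.1 hx, Finsupp.add_apply] at hai
      rw [coeff_killVarsFun, coeff_killVarsFun]
      by_cases h1 : x.1 i = 0
      · rw [if_pos (c := ∃ i ∈ α, x.2 i ≠ 0) ⟨i, hi, by omega⟩, mul_zero]
      · rw [if_pos (c := ∃ i ∈ α, x.1 i ≠ 0) ⟨i, hi, h1⟩, zero_mul]
    · rw [coeff_mul]
      refine Finset.sum_congr rfl fun x hx => ?_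
      rw [coeff_killVarsFun, coeff_killVarsFun, if_neg, if_neg]
      · rintro ⟨i, hi, hxi⟩
        refine h ⟨i, hi, ?_⟩
        rw [← Finset.HasAntidiagonal.mem_antidiagonal.1 hx, Finsupp.add_apply]
        omega
      · rintro ⟨i, hi, hxi⟩
        refine h ⟨i, hi, ?_⟩
        rw [← Finset.HasAntidiagonal.mem_antidiagonal.1 hx, Finsupp.add_apply]
        omega

theorem ker_killVars (α : Finset σ) : RingHom.ker (killVars k α) = varsIdeal k α := by
  classical
  ext f
  rw [RingHom.mem_ker, MvPowerSeries.ext_iff]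
  refine forall_congr' fun a => ?_
  change coeff a (killVarsFun α f) = 0 ↔ (coeff a f ≠ 0 → a ∈ {a : σ →₀ ℕ | ∃ i ∈ α, a i ≠ 0})
  rw [coeff_killVarsFun]
  split_ifs with h
  · exact ⟨fun _ _ => h, fun _ => rfl⟩
  · exact ⟨fun h0 hne => (hne h0).elim, fun h' => by
      by_contra hne
      exact h (h' hne)⟩

instance isPrime_varsIdeal (α : Finset σ) : (varsIdeal k α).IsPrime := by
  have : IsDomain (MvPowerSeries σ k) := NoZeroDivisors.to_isDomain _
  rw [← ker_killVars]
  exact RingHom.ker_isPrime _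

theorem X_mem_varsIdeal {α : Finset σ} {i : σ} :
    (X i : MvPowerSeries σ k) ∈ varsIdeal k α ↔ i ∈ α := by
  classical
  refine monomial_mem_exponentIdeal.trans ?_
  constructor
  · rintro ⟨j, hj, h⟩
    rw [Finsupp.single_apply] at h
    split_ifs at h with hij
    · exact hij ▸ hj
    · exact (h rfl).elim
  · intro hi
    exact ⟨i, hi, by simp⟩

theorem varsIdeal_le_iff [Finite σ] {α : Finset σ} {J : Ideal (MvPowerSeries σ k)} :
    varsIdeal k α ≤ J ↔ ∀ i ∈ α, (X i : MvPowerSeries σ k) ∈ J := by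
  refine ⟨fun h i hi => h (X_mem_varsIdeal.2 hi), fun h f hf => ?_⟩
  refine mem_span_monomial_of_forall (fun i : α => Finsupp.single i.1 1) (fun i => h i.1 i.2)
    fun a ha => ?_
  obtain ⟨i, hi, hai⟩ := hf a ha
  exact ⟨⟨i, hi⟩, Finsupp.single_le_iff.2 (Nat.one_le_iff_ne_zero.2 hai)⟩

theorem varsIdeal_le_varsIdeal_iff [Finite σ] {α β : Finset σ} :
    varsIdeal k α ≤ varsIdeal k β ↔ α ⊆ β := by
  rw [varsIdeal_le_iff]
  exact forall₂_congr fun i _ => X_mem_varsIdeal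

theorem varsIdeal_empty : varsIdeal k (∅ : Finset σ) = ⊥ := by
  refine (Submodule.eq_bot_iff _).2 fun f hf => ?_
  ext a
  by_contra h
  obtain ⟨i, hi, -⟩ := hf a h
  simp at hi

theorem one_lt_height_varsIdeal_of_card [Finite σ] {α : Finset σ} (h : 1 < α.card) :
    1 < (varsIdeal k α).height := by
  obtain ⟨i, hi, j, hj, hij⟩ := Finset.one_lt_card.1 h
  have h1 : varsIdeal k (∅ : Finset σ) < varsIdeal k {i} := by
    refine lt_of_le_not_ge (varsIdeal_le_varsIdeal_iff.2 (Finset.empty_subset _)) fun hc => ?_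
    simpa using varsIdeal_le_varsIdeal_iff.1 hc
  have h2 : varsIdeal k {i} < varsIdeal k α := by
    refine lt_of_le_not_ge (varsIdeal_le_varsIdeal_iff.2 (by simpa using hi)) fun hc => ?_
    have := varsIdeal_le_varsIdeal_iff.1 hc hj
    exact hij (Finset.mem_singleton.1 this).symm
  have h3 := Ideal.height_add_one_le_of_lt_of_isPrime h1
  have h4 := Ideal.height_add_one_le_of_lt_of_isPrime h2
  have h5 : (1 : ℕ∞) + 1 ≤ (varsIdeal k α).height :=
    (add_le_add_left (le_add_self.trans h3) 1).trans h4
  exact lt_of_lt_of_le (by norm_num) h5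

theorem height_varsIdeal_le_one [Finite σ] {α : Finset σ} (h : α.card ≤ 1) :
    (varsIdeal k α).height ≤ 1 := by
  rcases α.eq_empty_or_nonempty with rfl | hα
  · rw [varsIdeal_empty, Ideal.height_bot]
    exact zero_le_one
  · obtain ⟨i, rfl⟩ := Finset.card_eq_one.1 (le_antisymm h (Finset.card_pos.2 hα))
    have hX : ¬ IsUnit (X i : MvPowerSeries σ k) :=
      (IsLocalRing.mem_maximalIdeal _).1 (mem_maximalIdeal_iff.2 (by simp))
    refine (Ideal.height_mono (varsIdeal_le_iff.2 fun j hj => ?_)).trans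
      (Ideal.height_span_singleton_le_one hX)
    rw [Finset.mem_singleton.1 hj]
    exact Ideal.mem_span_singleton_self _

theorem card_eq_one_of_height_eq_one [Finite σ] {α : Finset σ} (h : (varsIdeal k α).height = 1) :
    α.card = 1 := by
  refine le_antisymm ?_ (Finset.card_pos.2 (Finset.nonempty_iff_ne_empty.2 ?_))
  · by_contra! hc
    exact (one_lt_height_varsIdeal_of_card hc).ne' h
  · rintro rfl
    rw [varsIdeal_empty, Ideal.height_bot] at h
    exact zero_ne_one h

variable {G : Set (Finset σ)}

theorem exponentIdeal_le_varsIdeal_iff {α : Finset σ} :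
    exponentIdeal k _ (isUpperSet_monomialExponents G 1) ≤ varsIdeal k α ↔ IsVertexCover G α := by
  constructor
  · intro h g hg
    have h1 : monomial (∑ i ∈ g, Finsupp.single i 1) (1 : k) ∈ varsIdeal k α :=
      h (monomial_mem_exponentIdeal.2 ⟨g, hg, sum_single_le_iff.1 le_rfl⟩)
    classical
    obtain ⟨i, hi, hne⟩ := monomial_mem_exponentIdeal.1 h1
    rw [sum_single_apply] at hne
    exact ⟨i, by_contra fun hc => hne (if_neg hc), hi⟩
  · intro h f hf a ha
    obtain ⟨g, hg, hga⟩ := hf a ha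
    obtain ⟨i, hig, hi⟩ := h g hg
    exact ⟨i, hi, Nat.one_le_iff_ne_zero.1 (hga i hig)⟩

variable [Fintype σ]

/-- The variables in a prime ideal containing `I` form a vertex cover. -/
theorem exists_isVertexCover_of_le {P : Ideal (MvPowerSeries σ k)} [P.IsPrime]
    (h : exponentIdeal k _ (isUpperSet_monomialExponents G 1) ≤ P) :
    ∃ α, IsVertexCover G α ∧ varsIdeal k α ≤ P := by
  classical
  refine ⟨Finset.univ.filter fun i => (X i : MvPowerSeries σ k) ∈ P, fun g hg => ?_,
    varsIdeal_le_iff.2 fun i hi => by simpa using hi⟩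
  have h1 : (∏ i ∈ g, (X i : MvPowerSeries σ k)) ∈ P := by
    refine h ?_
    rw [← pow_one (∏ i ∈ g, _), prod_X_pow_eq_monomial]
    exact monomial_mem_exponentIdeal.2 ⟨g, hg, sum_single_le_iff.1 le_rfl⟩
  obtain ⟨i, hi, hiP⟩ := (Ideal.IsPrime.prod_mem_iff (hp := ‹P.IsPrime›)).1 h1
  exact ⟨i, hi, by simpa using hiP⟩

/-- The minimal primes of a squarefree monomial ideal. -/
theorem mem_minimalPrimes_iff {P : Ideal (MvPowerSeries σ k)} :
    P ∈ (exponentIdeal k _ (isUpperSet_monomialExponents G 1)).minimalPrimes ↔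
      ∃ α, IsMinimalCover G α ∧ P = varsIdeal k α := by
  constructor
  · intro hP
    have := hP.1.1
    obtain ⟨α, hα, hle⟩ := exists_isVertexCover_of_le hP.1.2
    obtain ⟨β, hβα, hβ⟩ := hα.exists_minimal
    have hle' : varsIdeal k β ≤ P := (varsIdeal_le_varsIdeal_iff.2 hβα).trans hle
    exact ⟨β, hβ, le_antisymm
      (hP.2 ⟨isPrime_varsIdeal β, exponentIdeal_le_varsIdeal_iff.2 hβ.1⟩ hle') hle'⟩
  · rintro ⟨α, hα, rfl⟩
    refine ⟨⟨isPrime_varsIdeal α, exponentIdeal_le_varsIdeal_iff.2 hα.1⟩, ?_⟩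
    rintro Q ⟨hQ, hIQ⟩ hle
    obtain ⟨β, hβ, hβQ⟩ := exists_isVertexCover_of_le hIQ
    exact (varsIdeal_le_varsIdeal_iff.2
      (hα.2 hβ (varsIdeal_le_varsIdeal_iff.1 (hβQ.trans hle)))).trans hβQ

theorem mem_coverVars_of_sSup_eq
    (h : sSup (exponentIdeal k _ (isUpperSet_monomialExponents G 1)).minimalPrimes =
      IsLocalRing.maximalIdeal (MvPowerSeries σ k)) (i : σ) : i ∈ coverVars G := by
  classical
  have hle : sSup (exponentIdeal k _ (isUpperSet_monomialExponents G 1)).minimalPrimes ≤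
      varsIdeal k (Finset.univ.filter fun i => i ∈ coverVars G) := by
    refine sSup_le fun P hP => ?_
    obtain ⟨α, hα, rfl⟩ := mem_minimalPrimes_iff.1 hP
    exact varsIdeal_le_varsIdeal_iff.2 fun j hj => by simpa using ⟨α, hα, hj⟩
  have hX : (X i : MvPowerSeries σ k) ∈ IsLocalRing.maximalIdeal (MvPowerSeries σ k) :=
    mem_maximalIdeal_iff.2 (by simp)
  rw [← h] at hX
  simpa using X_mem_varsIdeal.1 (hle hX)

/-- A squarefree monomial ideal of height one has a minimal prime generated by one variable. -/
theorem exists_isMinimalCover_card_eq_one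
    (h : (exponentIdeal k _ (isUpperSet_monomialExponents G 1)).height = 1) :
    ∃ α, IsMinimalCover G α ∧ α.card = 1 := by
  obtain ⟨P, _, hIP, hP⟩ := Ideal.exists_isPrime_height_eq (n := 1) (by exact_mod_cast h)
  obtain ⟨α, hα, hle⟩ := exists_isVertexCover_of_le hIP
  obtain ⟨β, hβα, hβ⟩ := hα.exists_minimal
  refine ⟨β, hβ, card_eq_one_of_height_eq_one (k := k) (le_antisymm ?_ ?_)⟩
  · have := Ideal.height_mono ((varsIdeal_le_varsIdeal_iff (k := k).2 hβα).trans hle)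
    rw [hP] at this
    exact_mod_cast this
  · rw [← h]
    exact Ideal.height_mono (exponentIdeal_le_varsIdeal_iff.2 hβ.1)

/-- The equality `(I^{[q]} : I) = I^{[q]} + (u^{q-1})` holds if and only if there is no obstruction;
here all variables occur in the minimal primes. -/
theorem colon_eq_iff (hA : ∀ i, i ∈ coverVars G) {q : ℕ} (hq : 2 ≤ q) :
    exponentIdeal k _ (isUpperSet_colonExponents G q) =
        exponentIdeal k _ (isUpperSet_monomialExponents G q) ⊔
          Ideal.span {(∏ i, (X i : MvPowerSeries σ k)) ^ (q - 1)} ↔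
      ∀ T, ¬ IsObstruction G T := by
  classical
  have hw : ∀ {b : σ →₀ ℕ}, ∑ i ∈ Finset.univ, Finsupp.single i (q - 1) ≤ b ↔
      ∀ i, q ≤ b i + 1 := by
    intro b
    rw [sum_single_le_iff]
    simp only [Finset.mem_univ, true_imp_iff, tsub_le_iff_right]
  rw [prod_X_pow_eq_monomial]
  set w : σ →₀ ℕ := ∑ i ∈ Finset.univ, Finsupp.single i (q - 1)
  constructor
  · intro h T hT
    have hup : IsUpperSet (monomialExponents G q ∪ Set.Ici w) :=
      (isUpperSet_monomialExponents G q).union (isUpperSet_Ici w)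
    have hle : exponentIdeal k _ (isUpperSet_colonExponents G q) ≤ exponentIdeal k _ hup := by
      rw [h, sup_le_iff, Ideal.span_singleton_le_iff_mem]
      exact ⟨fun f hf a ha => .inl (hf a ha),
        monomial_mem_exponentIdeal.2 (.inr (Set.self_mem_Ici))⟩
    rcases monomial_mem_exponentIdeal.1 (hle (monomial_mem_exponentIdeal.2
      (obstructionExponent_mem_colon G T q))) with h1 | h1
    · exact obstructionExponent_notMem hT (by omega) h1
    · obtain ⟨i, -, hi⟩ := exists_obstructionExponent_eq_zero hT q
      have := hw.1 h1 i
      omega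
  · intro h
    refine le_antisymm (fun f hf => ?_) (sup_le (fun f hf a ha => ?_) ?_)
    · obtain ⟨g, hg⟩ := exists_coeff_mul_monomial_eq (N := monomialExponents G q) w f
        fun b hb hbN => hw.2 fun i => le_add_one_of_not_isObstruction h (hf b hb) hbN (hA i)
      rw [← sub_add_cancel f (g * monomial w 1)]
      refine Ideal.add_mem _ (Ideal.mem_sup_left fun b hb => hg b fun heq => hb ?_)
        (Ideal.mem_sup_right (Ideal.mul_mem_left _ _ (Ideal.mem_span_singleton_self _)))
      rw [map_sub, heq, sub_self]
    · exact fun c _ => monomialExponents_mono le_self_add (hf a ha)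
    · rw [Ideal.span_singleton_le_iff_mem]
      exact monomial_mem_exponentIdeal.2 (mem_colonExponents_of_le fun i _ => hw.1 le_rfl i)

end MinimalPrimes
end

/-! ### The dichotomy -/

theorem proposition3p4 {k : Type u} [Field k] (p : ℕ) [Fact p.Prime] [CharP k p] {n : ℕ}
    (I : Ideal (MvPowerSeries (Fin n) k)) (hI : IsSquarefreeMonomialIdeal I)
    [Nontrivial (MvPowerSeries (Fin n) k ⧸ I)]
    (E : Type u) [AddCommGroup E] [Module (MvPowerSeries (Fin n) k ⧸ I) E]
    (hE : IsInjectiveHullOfResidueField (MvPowerSeries (Fin n) k ⧸ I) E) :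
    (sSup I.minimalPrimes = IsLocalRing.maximalIdeal (MvPowerSeries (Fin n) k) →
      -- all components have height `> 1` and `(I^{[q]} : I) = I^{[q]} + (x₁ ⋯ xₙ)^{q-1}`,
      -- or all components have height `1`
      (((∃ e : ℕ, 1 ≤ e ∧ (∀ P ∈ I.minimalPrimes, 1 < P.height) ∧
            (frobeniusPower I (p ^ e)).colon (I : Set (MvPowerSeries (Fin n) k)) =
              frobeniusPower I (p ^ e) ⊔ Ideal.span {prodVars k n ^ (p ^ e - 1)}) ∨
          (∀ P ∈ I.minimalPrimes, P.height = 1)) →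
        FrobeniusPrincipallyGenerated p (MvPowerSeries (Fin n) k ⧸ I) E ∧
        ∀ (E' : Type u) [AddCommGroup E'] [Module (MvPowerSeries (Fin n) k) E'],
          IsInjectiveHullOfResidueField (MvPowerSeries (Fin n) k) E' →
          FrobeniusAlgebraIsSkewPolynomialOn p I E E' (prodVars k n ^ (p - 1))) ∧
      -- all components have height `> 1` and `(I^{[q]} : I) ≠ I^{[q]} + (x₁ ⋯ xₙ)^{q-1}`,
      -- or `I` has height `1` and some component has height `> 1`
      (((∃ e : ℕ, 1 ≤ e ∧ (∀ P ∈ I.minimalPrimes, 1 < P.height) ∧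
            (frobeniusPower I (p ^ e)).colon (I : Set (MvPowerSeries (Fin n) k)) ≠
              frobeniusPower I (p ^ e) ⊔ Ideal.span {prodVars k n ^ (p ^ e - 1)}) ∨
          (I.height = 1 ∧ ∃ P ∈ I.minimalPrimes, 1 < P.height)) →
        ¬ FrobeniusFinitelyGenerated p (MvPowerSeries (Fin n) k ⧸ I) E)) ∧
    (FrobeniusPrincipallyGenerated p (MvPowerSeries (Fin n) k ⧸ I) E ∨
      ¬ FrobeniusFinitelyGenerated p (MvPowerSeries (Fin n) k ⧸ I) E) := by
  classical
  obtain ⟨G, hG⟩ := hI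
  rw [span_prod_X_eq] at hG
  obtain ⟨ι, hι, hsmul, hrange⟩ := InversePolynomial.exists_embedding hE
  have hS : IsInverseSystem G I ι := ⟨hG, hι, hsmul, by
    rw [hrange, hG]
    exact Set.ext fun y => InversePolynomial.forall_smul_eq_zero_iff⟩
  have two_le : ∀ e, 1 ≤ e → 2 ≤ p ^ e := fun e he =>
    (Fact.out : p.Prime).two_le.trans (Nat.le_self_pow (by omega) p)
  refine ⟨fun hsum => ?_, ?_⟩
  · have hA : ∀ i, i ∈ coverVars G := mem_coverVars_of_sSup_eq (k := k) (hG ▸ hsum)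
    have hcolon : ∀ e, 1 ≤ e →
        ((frobeniusPower I (p ^ e)).colon (I : Set (MvPowerSeries (Fin n) k)) =
          frobeniusPower I (p ^ e) ⊔ Ideal.span {prodVars k n ^ (p ^ e - 1)} ↔
            ∀ T, ¬ IsObstruction G T) := by
      intro e he
      rw [hG, frobeniusPower_exponentIdeal, colon_exponentIdeal]
      exact colon_eq_iff hA (two_le e he)
    refine ⟨fun h => ?_, fun h => hS.not_frobeniusFinitelyGenerated ?_⟩
    · have hobs : ∀ T, ¬ IsObstruction G T := by
        rcases h with ⟨e, he, -, h⟩ | h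
        · exact (hcolon e he).1 h
        · refine not_isObstruction_of_card_eq_one fun α hα => ?_
          exact card_eq_one_of_height_eq_one (h _ (hG ▸ mem_minimalPrimes_iff.2 ⟨α, hα, rfl⟩))
      exact ⟨hS.frobeniusPrincipallyGenerated hobs, fun E' _ _ hE' =>
        hS.frobeniusAlgebraIsSkewPolynomialOn hobs hA hE'⟩
    · rcases h with ⟨e, he, -, h⟩ | ⟨hI1, P, hP, hP1⟩
      · rw [Ne, hcolon e he] at h
        push Not at h
        exact h
      · rw [hG] at hI1 hP
        obtain ⟨α, hα, hα1⟩ := exists_isMinimalCover_card_eq_one hI1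
        obtain ⟨β, hβ, rfl⟩ := mem_minimalPrimes_iff.1 hP
        refine exists_isObstruction_of_card hα hα1 hβ ?_
        by_contra! hc
        exact (height_varsIdeal_le_one hc).not_gt hP1
  · by_cases hobs : ∃ T, IsObstruction G T
    · exact .inr (hS.not_frobeniusFinitelyGenerated hobs)
    · push Not at hobs
      exact .inl (hS.frobeniusPrincipallyGenerated hobs)
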